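/- Let $Q\colon\mathbb C[x]\to\mathbb C[x]$ be a normalized delta operator: a linear operator that commutes with all shifts $f(x)\mapsto f(x+a)$, annihilates constants, lowers the degree of every nonconstant polynomial by exactly one, and whose expansion $Q=D+a_2D^2+a_3D^3+\cdots$ in powers of $D=d/dx$ has coefficient $1$ at $D$. Let $p_n\in\mathbb C[x]$ $(n\ge 0)$ be its basic polynomials, i.e. $p_0=1$, $Qp_n=n\,p_{n-1}$ and $p_n(0)=0$ for $n\ge1$, and put $p^*_n(x)=x^{-1}p_{n+1}(x)$ for $n\ge 0$. Extend $Q=\sum_k a_kD^k$ to $\mathbb C((x^{-1}))$ and extend the two sequences to all $n\in\mathbb Z$, with values in $\mathbb C((x^{-1}))$, by $p^*_{-1}=x^{-1}$, $Qp^*_n=n\,p^*_{n-1}$ for $n<0$, and $p_{n}=x\,p^*_{n-1}$ for $n<0$. For $\lambda=(\lambda_1,\dots,\lambda_N)\in\mathbb Z^N$ put $$s_\lambda(x_1,\dots,x_N)=\frac{\det\bigl(p_{\lambda_i+N-i}(x_j)\bigr)_{1\le i,j\le N}}{\det\bigl(p_{N-i}(x_j)\bigr)_{1\le i,j\le N}},\qquad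 s^*_\lambda(x_1,\dots,x_N)=\frac{\det\bigl(p^*_{\lambda_i+N-i}(x_j)\bigr)_{1\le i,j\le N}}{\det\bigl(p^*_{N-i}(x_j)\bigr)_{1\le i,j\le N}},$$ which are elements of the ring $\mathbb C((x_1^{-1},\dots,x_N^{-1}))$ of formal series in monomials with integer exponents bounded above in each variable, and polynomials if all $\lambda_i\ge0$. Then for all $M,N\ge0$ the elements $y_j+x_i$ are invertible in $\mathbb C[x_1,\dots,x_M]((y_1^{-1},\dots,y_N^{-1}))$, and in this ring $$\prod_{i=1}^{M}\prod_{j=1}^{N}\frac1{y_j+x_i}=\sum_\lambda(-1)^{|\lambda|}\,s^*_\lambda(x_1,\dots,x_M)\,s_{\lambda^\ddagger}(y_1,\dots,y_N)=\sum_\lambda(-1)^{|\lambda|}\,s_\lambda(x_1,\dots,x_M)\,s^*_{\lambda^\ddagger}(y_1,\dots,y_N).$$ Here $\lambda$ runs over all Young diagrams with at most $\min(M,N)$ rows, with row lengths $\lambda_1\ge\lambda_2\ge\cdots$ ($\lambda_i=0$ beyond the last row) and $|\lambda|$ boxes, and $\lambda^\ddagger=(-M-\lambda_N,-M-\lambda_{N-1},\dots,-M-\lambda_1)\in\mathbb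 Z^N$. The sums are formal: the $y$-exponents of all terms have a common upper bound in each variable, each $y$-monomial occurs in only finitely many terms, and coefficients are added. -/

import Mathlib

namespace SchurType

open Polynomial

/-- A delta operator on `ℂ[x]`: a linear operator that lowers degrees by one (and kills constants)
and commutes with all shifts `f(x) ↦ f(x + a)`. -/
structure DeltaOperator where
  toLin : ℂ[X] →ₗ[ℂ] ℂ[X]
  map_C : ∀ c : ℂ, toLin (C c) = 0
  degree_map : ∀ f : ℂ[X], 0 < f.degree → (toLin f).degree + 1 = f.degree
  map_shift : ∀ (a : ℂ) (f : ℂ[X]), toLin (f.comp (X + C a)) = (toLin f).comp (X + C a)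

namespace DeltaOperator

variable (Q : DeltaOperator)

theorem existsUnique_preimage (f : ℂ[X]) : ∃! g : ℂ[X], Q.toLin g = f ∧ g.eval 0 = 0 := by
  have surj : ∀ n : ℕ, ∀ f : ℂ[X], f.degree < n → ∃ g, Q.toLin g = f := by
    intro n
    induction n with
    | zero =>
      intro f hf
      have : f = 0 := by simpa [Nat.WithBot.lt_zero_iff] using hf
      exact ⟨0, by simp [this]⟩
    | succ n ih =>
      intro f hf
      by_cases h0 : f.degree < n
      · exact ih f h0
      have hfd : f.degree = n := by
        apply le_antisymm _ (not_lt.mp h0)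
        rcases eq_or_ne f 0 with rfl | hne
        · simp
        · rw [degree_eq_natDegree hne] at hf ⊢
          exact_mod_cast Nat.lt_succ_iff.mp (by exact_mod_cast hf)
      have hX : (Q.toLin (X ^ (n + 1))).degree = n := by
        have h := Q.degree_map (X ^ (n + 1)) (by simp; positivity)
        rw [degree_X_pow] at h
        push_cast at h
        exact WithBot.add_right_cancel (by simp) h
      have hX0 : Q.toLin (X ^ (n + 1)) ≠ 0 := by
        intro h; rw [h] at hX; simp at hX
      set q := Q.toLin (X ^ (n + 1)) with hq
      have hlc : q.leadingCoeff ≠ 0 := by simpa using hX0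
      have hf0 : f ≠ 0 := by rintro rfl; simp at hfd
      have hlf : f.leadingCoeff ≠ 0 := by simpa using hf0
      have hdeg : (C (f.leadingCoeff / q.leadingCoeff) * q).degree = f.degree := by
        rw [degree_C_mul (div_ne_zero hlf hlc), hX, hfd]
      obtain ⟨g, hg⟩ := ih (f - C (f.leadingCoeff / q.leadingCoeff) * q) (by
        rw [← hfd]
        exact degree_sub_lt_left hdeg.symm hf0 (by simp [hlc]))
      refine ⟨g + (f.leadingCoeff / q.leadingCoeff) • X ^ (n + 1), ?_⟩
      rw [map_add, map_smul, hg, ← hq, smul_eq_C_mul]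
      ring
  obtain ⟨g, hg⟩ := surj (f.natDegree + 1) f
    (lt_of_le_of_lt degree_le_natDegree (by exact_mod_cast Nat.lt_succ_self _))
  refine ⟨g - C (g.eval 0), ⟨by rw [map_sub, Q.map_C, hg, sub_zero], by simp⟩, ?_⟩
  rintro g' ⟨h1, h2⟩
  have hz : Q.toLin (g' - g) = 0 := by rw [map_sub, h1, hg, sub_self]
  have hd : (g' - g).degree ≤ 0 := by
    by_contra hlt
    have := Q.degree_map _ (not_le.mp hlt)
    rw [hz] at this
    rw [← this] at hlt
    simp at hlt
  have hc := eq_C_of_degree_le_zero hd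
  have hev : (g' - g).coeff 0 = - g.eval 0 := by
    have := congrArg (eval 0) hc
    rw [eval_sub, h2, eval_C] at this
    rw [← this]; ring
  rw [hev] at hc
  rw [sub_eq_iff_eq_add.mp hc, map_neg]
  ring

/-- The sequence `p_n` (`n ≥ 0`) of binomial type belonging to `Q` (the basic polynomials):
`p_0 = 1`, and `p_{n+1}` is the unique polynomial with
`Q p_{n+1} = (n+1) p_n` and `p_{n+1}(0) = 0`. -/
noncomputable def basic : ℕ → ℂ[X]
  | 0 => 1
  | n + 1 => Classical.choose (Q.existsUnique_preimage ((n + 1 : ℂ) • basic n)).exists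

theorem basic_spec (n : ℕ) :
    Q.toLin (Q.basic (n + 1)) = (n + 1 : ℂ) • Q.basic n ∧ (Q.basic (n + 1)).eval 0 = 0 := by
  rw [basic]
  exact Classical.choose_spec (Q.existsUnique_preimage ((n + 1 : ℂ) • Q.basic n)).exists

/-- The polynomials `p*_n(x) = x⁻¹ p_{n+1}(x)` for `n ≥ 0`. -/
noncomputable def basicStar (n : ℕ) : ℂ[X] := (Q.basic (n + 1)).divX

theorem X_mul_basicStar (n : ℕ) : X * Q.basicStar n = Q.basic (n + 1) := by
  have h := X_mul_divX_add (Q.basic (n + 1))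
  rwa [coeff_zero_eq_eval_zero, (Q.basic_spec n).2, C_0, add_zero] at h

/-- The coefficient `a_k` of `D ^ k` in the expansion `Q = ∑ a_k D ^ k`, `D = d/dx`:
as `D ^ j x ^ k` vanishes at `0` for `j ≠ k` and is `k!` for `j = k`, it is `(Q x ^ k)(0) / k!`. -/
noncomputable def diffCoeff (k : ℕ) : ℂ := (Q.toLin (X ^ k)).eval 0 / (k.factorial : ℂ)

theorem toLin_X_pow (n : ℕ) : Q.toLin (X ^ n) =
    ∑ k ∈ Finset.range (n + 1), Q.diffCoeff k • derivative^[k] (X ^ n) := by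
  apply Polynomial.funext
  intro a
  have h := congrArg (eval 0) (Q.map_shift a (X ^ n))
  rw [eval_comp, X_pow_comp, add_pow] at h
  simp only [eval_add, eval_X, eval_C, zero_add, map_sum] at h
  rw [← h, eval_finsetSum, eval_finsetSum]
  refine Finset.sum_congr rfl fun k hk => ?_
  have h1 : (X : ℂ[X]) ^ k * C a ^ (n - k) * (n.choose k : ℂ[X])
      = (a ^ (n - k) * n.choose k : ℂ) • X ^ k := by
    rw [smul_eq_C_mul]; simp; ring
  rw [h1, map_smul, eval_smul, eval_smul, iterate_derivative_X_pow_eq_natCast_mul, diffCoeff]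
  have h2 : (n.descFactorial k : ℂ) = k.factorial * n.choose k := by
    exact_mod_cast Nat.descFactorial_eq_factorial_mul_choose n k
  have h3 : (k.factorial : ℂ) ≠ 0 := by exact_mod_cast k.factorial_ne_zero
  simp only [smul_eq_mul, eval_mul, eval_natCast, eval_pow, eval_X, h2]
  field_simp

/-- `Q = ∑ a_k D ^ k` on `ℂ[x]`. -/
theorem toLin_eq_sum (f : ℂ[X]) : Q.toLin f =
    ∑ k ∈ Finset.range (f.natDegree + 1), Q.diffCoeff k • derivative^[k] f := by
  have key : ∀ m, ∀ f : ℂ[X], f.natDegree ≤ m → Q.toLin f =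
      ∑ k ∈ Finset.range (m + 1), Q.diffCoeff k • derivative^[k] f := by
    intro m f hf
    conv_lhs => rw [f.as_sum_range_C_mul_X_pow' (Nat.lt_succ_of_le hf)]
    rw [map_sum]
    have : ∀ i ∈ Finset.range (m + 1), Q.toLin (C (f.coeff i) * X ^ i) =
        ∑ k ∈ Finset.range (m + 1), Q.diffCoeff k • derivative^[k] (C (f.coeff i) * X ^ i) := by
      intro i hi
      rw [← smul_eq_C_mul, map_smul, Q.toLin_X_pow, Finset.smul_sum]
      have hi' : i + 1 ≤ m + 1 := by simpa using hi
      rw [← Finset.sum_subset (Finset.range_subset_range.mpr hi')]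
      · refine Finset.sum_congr rfl fun k _ => ?_
        rw [iterate_derivative_smul, smul_comm]
      · intro k _ hk
        rw [iterate_derivative_smul, iterate_derivative_eq_zero, smul_zero, smul_zero]
        simp at hk ⊢; omega
    rw [Finset.sum_congr rfl this, Finset.sum_comm]
    refine Finset.sum_congr rfl fun k _ => ?_
    rw [← Finset.smul_sum, ← iterate_derivative_sum,
      ← f.as_sum_range_C_mul_X_pow' (Nat.lt_succ_of_le hf)]
  exact key _ f le_rfl

/-- `Q` is normalized when the coefficient of `D` in `Q = ∑ a_k D ^ k` is `1`. -/
def IsNormalized : Prop := Q.diffCoeff 1 = 1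

theorem basic_monic (hQ : Q.IsNormalized) (n : ℕ) :
    (Q.basic n).Monic ∧ (Q.basic n).natDegree = n := by
  have hcoeff : ∀ f : ℂ[X], ∀ m : ℕ, f.natDegree = m + 1 →
      (Q.toLin f).coeff m = (m + 1) * f.leadingCoeff := by
    intro f m hf
    have h0 : Q.diffCoeff 0 = 0 := by
      have := Q.map_C 1
      simp only [map_one] at this
      simp [diffCoeff, this]
    rw [Q.toLin_eq_sum, finsetSum_coeff, Finset.sum_eq_single 1]
    · rw [show Q.diffCoeff 1 = 1 from hQ, one_smul, Function.iterate_one, coeff_derivative,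
        leadingCoeff, hf, mul_comm]
    · intro k hk hk1
      rcases Nat.lt_or_ge k 1 with h | h
      · obtain rfl : k = 0 := by omega
        rw [h0, zero_smul, coeff_zero]
      · rw [coeff_smul, coeff_eq_zero_of_natDegree_lt, smul_zero]
        have := natDegree_iterate_derivative f k
        simp at hk
        omega
    · simp [hf]
  induction n with
  | zero => simp [basic]
  | succ n ih =>
    obtain ⟨h1, h2⟩ := Q.basic_spec n
    have hn : (n + 1 : ℂ) ≠ 0 := by exact_mod_cast n.succ_ne_zero
    have hne : Q.basic n ≠ 0 := ih.1.ne_zero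
    have hpos : 0 < (Q.basic (n + 1)).degree := by
      by_contra h
      rw [eq_C_of_degree_le_zero (not_lt.mp h), Q.map_C] at h1
      exact smul_ne_zero hn hne h1.symm
    have hd := Q.degree_map _ hpos
    rw [h1, degree_smul_of_smul_regular _ (IsSMulRegular.of_ne_zero hn),
      degree_eq_natDegree hne, ih.2] at hd
    have hnat : (Q.basic (n + 1)).natDegree = n + 1 :=
      natDegree_eq_of_degree_eq_some (by rw [← hd]; norm_cast)
    refine ⟨?_, hnat⟩
    have h3 := hcoeff _ n hnat
    have h4 : (Q.basic n).coeff n = 1 := by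
      have := ih.1.coeff_natDegree; rwa [ih.2] at this
    rw [h1, coeff_smul, smul_eq_mul, h4] at h3
    exact (mul_left_cancel₀ hn h3).symm

theorem basicStar_monic (hQ : Q.IsNormalized) (n : ℕ) :
    (Q.basicStar n).Monic ∧ (Q.basicStar n).natDegree = n := by
  obtain ⟨h1, h2⟩ := Q.basic_monic hQ (n + 1)
  have hd : (Q.basicStar n).natDegree = n := by
    rw [basicStar, natDegree_divX_eq_natDegree_tsub_one, h2]; rfl
  refine ⟨?_, hd⟩
  have := h1.coeff_natDegree
  rw [h2] at this
  rwa [Monic, leadingCoeff, hd, basicStar, coeff_divX]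


end DeltaOperator

/-- The field `ℂ((x⁻¹))`. Hahn series over `ℤ` are used with `x⁻¹` as the variable:
the coefficient at `n : ℤ` is the coefficient of `x ^ (-n)`. -/
abbrev LaurentAtInfty : Type := HahnSeries ℤ ℂ

/-- `d/dx` on `ℂ((x⁻¹))`: the coefficient of `x ^ (-n)` in `f'` is `1 - n` times the coefficient
of `x ^ (1 - n)` in `f`. -/
noncomputable def xDeriv (f : LaurentAtInfty) : LaurentAtInfty :=
  HahnSeries.ofSuppBddBelow (fun n : ℤ => (1 - n : ℂ) * f.coeff (n - 1)) (by
    suffices h : f.order ∈ lowerBounds _ from Set.nonempty_of_mem h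
    intro n hn
    by_contra hlt
    apply hn
    have h : f.coeff (n - 1) = 0 := HahnSeries.coeff_eq_zero_of_lt_order (by omega)
    simp only [h, mul_zero])

theorem coeff_xDeriv (f : LaurentAtInfty) (n : ℤ) :
    (xDeriv f).coeff n = (1 - n : ℂ) * f.coeff (n - 1) := rfl

theorem coeff_xDeriv_iterate_eq_zero (f : LaurentAtInfty) (k : ℕ) {n : ℤ}
    (hn : n < f.order + (k : ℤ)) : (xDeriv^[k] f).coeff n = 0 := by
  induction k generalizing n with
  | zero => exact HahnSeries.coeff_eq_zero_of_lt_order (by simpa using hn)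
  | succ k ih =>
    rw [Function.iterate_succ_apply', coeff_xDeriv, ih (by push_cast at hn; omega), mul_zero]

namespace DeltaOperator

variable (Q : DeltaOperator)

/-- The action of `Q = ∑ a_k D ^ k` on `ℂ((x⁻¹))`. Each coefficient of `∑ a_k D ^ k f` is a finite
sum. -/
noncomputable def onLaurent (f : LaurentAtInfty) : LaurentAtInfty :=
  HahnSeries.ofSuppBddBelow
    (fun n : ℤ => ∑ᶠ k : ℕ, Q.diffCoeff k * (xDeriv^[k] f).coeff n) (by
    suffices h : f.order ∈ lowerBounds _ from Set.nonempty_of_mem h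
    intro n hn
    by_contra hlt
    apply hn
    apply finsum_eq_zero_of_forall_eq_zero
    intro k
    rw [coeff_xDeriv_iterate_eq_zero f k (by omega), mul_zero])

theorem coeff_onLaurent (f : LaurentAtInfty) (n : ℤ) :
    (Q.onLaurent f).coeff n = ∑ᶠ k : ℕ, Q.diffCoeff k * (xDeriv^[k] f).coeff n := rfl

/-- `p*_{-1-k}` for `k ≥ 0`: `p*_{-1} = x⁻¹`, and `Q p*_n = n p*_{n-1}` with `n = -1-k`
determines `p*_{n-1}` from `p*_n`. -/
noncomputable def starNeg : ℕ → LaurentAtInfty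
  | 0 => HahnSeries.single 1 1
  | k + 1 => HahnSeries.C (-1 - k : ℂ)⁻¹ * Q.onLaurent (starNeg k)

/-- The inclusion `ℂ[x] → ℂ((x⁻¹))`. -/
noncomputable def ofPoly : ℂ[X] →+* LaurentAtInfty :=
  eval₂RingHom HahnSeries.C (HahnSeries.single (-1 : ℤ) (1 : ℂ))

/-- `p*_n` for all `n ∈ ℤ`. -/
noncomputable def pStar : ℤ → LaurentAtInfty
  | Int.ofNat n => ofPoly (Q.basicStar n)
  | Int.negSucc k => Q.starNeg k

/-- `p_n` for all `n ∈ ℤ`; for negative `n` it is `x p*_{n-1}`. -/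
noncomputable def p : ℤ → LaurentAtInfty
  | Int.ofNat n => ofPoly (Q.basic n)
  | Int.negSucc k => HahnSeries.single (-1) 1 * Q.starNeg (k + 1)

/-- `p_{n+1} = x p*_n` for all `n ∈ ℤ`. -/
theorem p_add_one (n : ℤ) : Q.p (n + 1) = HahnSeries.single (-1) 1 * Q.pStar n := by
  rcases n with n | k
  · change ofPoly (Q.basic (n + 1)) = _ * ofPoly (Q.basicStar n)
    rw [← X_mul_basicStar, map_mul]
    simp [ofPoly]
  · rcases k with _ | k
    · change ofPoly (Q.basic 0) = _ * HahnSeries.single 1 1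
      rw [basic, map_one, HahnSeries.single_mul_single]
      simp
    · rfl

/-- `Q p*_{-1-k} = (-1-k) p*_{-2-k}`. -/
theorem onLaurent_starNeg (k : ℕ) :
    Q.onLaurent (Q.starNeg k) = HahnSeries.C (-1 - k : ℂ) * Q.starNeg (k + 1) := by
  have : (-1 - k : ℂ) ≠ 0 := by
    rw [← neg_add', neg_ne_zero, add_comm]
    exact_mod_cast k.succ_ne_zero
  rw [starNeg, ← mul_assoc, ← map_mul, mul_inv_cancel₀ this, map_one, one_mul]

theorem coeff_ofPoly (f : ℂ[X]) (m : ℕ) : (ofPoly f).coeff (-m) = f.coeff m := by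
  induction f using Polynomial.induction_on' with
  | add f g hf hg => simp [hf, hg]
  | monomial n a =>
    simp only [ofPoly, coe_eval₂RingHom, eval₂_monomial, HahnSeries.single_pow, one_pow,
      HahnSeries.C_mul_eq_smul, HahnSeries.coeff_smul, HahnSeries.coeff_single, coeff_monomial,
      smul_eq_mul]
    split_ifs <;> first | (exfalso; simp at *; omega) | simp

end DeltaOperator

/-- The ring `R((y₁⁻¹, …, y_N⁻¹))` of all `∑ a_k y ^ k` whose exponents `k` are bounded above in
every coordinate. Hahn series over `Fin N → ℤ` with the product order are used with the `y_j⁻¹` as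
the variables: the coefficient at `n : Fin N → ℤ` is the coefficient of
`y₁ ^ (-n₁) ⋯ y_N ^ (-n_N)`. A set of such `n` is partially well-ordered if and only if it is
bounded below. -/
abbrev MvLaurentAtInfty (N : ℕ) (R : Type) [Zero R] : Type := HahnSeries (Fin N → ℤ) R

/-- A set in `ℤ ^ N` is partially well-ordered if and only if it is bounded below. -/
theorem isPWO_iff_bddBelow {N : ℕ} (s : Set (Fin N → ℤ)) : s.IsPWO ↔ BddBelow s := by
  constructor
  · intro hs
    have h : ∀ i, BddBelow ((fun n : Fin N → ℤ => n i) '' s) := by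
      intro i
      have hi : ((fun n : Fin N → ℤ => n i) '' s).IsPWO :=
        hs.image_of_monotone (fun a b hab => hab i)
      rcases ((fun n : Fin N → ℤ => n i) '' s).eq_empty_or_nonempty with he | hne
      · rw [he]; exact bddBelow_empty
      · exact ⟨hi.isWF.min hne, fun m hm => hi.isWF.min_le hne hm⟩
    choose b hb using h
    exact ⟨b, fun n hn i => hb i ⟨n, hn, rfl⟩⟩
  · rintro ⟨b, hb⟩
    have h : (Set.range fun m : Fin N → ℕ => b + fun i => (m i : ℤ)).IsPWO := by
      rw [← Set.image_univ]
      refine Set.IsPWO.image_of_monotone (Set.isPWO_of_wellQuasiOrderedLE _) (fun m m' hm i => ?_)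
      have := hm i
      simpa using this
    refine h.mono fun n hn => ⟨fun i => (n i - b i).toNat, ?_⟩
    funext i
    have : b i ≤ n i := hb hn i
    simp [this]

/-- The variable `y_j`. -/
noncomputable def yVar {N : ℕ} (R : Type) [CommRing R] (j : Fin N) : MvLaurentAtInfty N R :=
  HahnSeries.single (Pi.single j (-1)) 1

/-- Substitution `f ↦ f(y_j)` from `ℂ((x⁻¹))` to `ℂ((y₁⁻¹, …, y_N⁻¹))`. -/
noncomputable def evalAt {N : ℕ} (j : Fin N) : LaurentAtInfty →+* MvLaurentAtInfty N ℂ :=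
  HahnSeries.embDomainRingHom (AddMonoidHom.single (fun _ : Fin N => ℤ) j)
    (by intro a b h; simpa using congrFun h j) (fun a b => Pi.single_le_single)

/-- The quotient `a / b` in a commutative ring; used only where it exists and is unique. -/
noncomputable def exactQuot {A : Type} [CommRing A] (a b : A) : A :=
  Classical.epsilon fun q => q * b = a

/-- `det (f_{λ_i + N - i}(y_j))` for `λ ∈ ℤ ^ N`. Rows and columns are indexed from `0`, so that
`N - i` becomes `Fin.rev i`. -/
noncomputable def alternant {N : ℕ} (f : ℤ → LaurentAtInfty) (l : Fin N → ℤ) :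
    MvLaurentAtInfty N ℂ :=
  Matrix.det (Matrix.of fun i j : Fin N => evalAt j (f (l i + ((Fin.rev i : ℕ) : ℤ))))

/-- The same determinant for `λ` with nonnegative entries, as a polynomial. -/
noncomputable def alternantPoly {N : ℕ} (f : ℕ → ℂ[X]) (l : Fin N → ℕ) :
    MvPolynomial (Fin N) ℂ :=
  Matrix.det (Matrix.of fun i j : Fin N => aeval (MvPolynomial.X j) (f (l i + (Fin.rev i : ℕ))))


section Quotients

variable {N : ℕ}

theorem det_dividedDifferences {A : Type} [CommRing A] (y : Fin N → A) (e : Fin N → ℕ → Fin N → A)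
    (h : ∀ (i k j : Fin N), k < j → e i (k + 1) j * (y k - y j) = e i k j - e i k k) :
    ∃ q : A, Matrix.det (Matrix.of fun i j => e i 0 j) =
      q * ∏ a : Fin N, ∏ b ∈ Finset.Ioi a, (y a - y b) := by
  have key : ∀ k : ℕ, k ≤ N → Matrix.det (Matrix.of fun i j => e i 0 j) =
      (∏ a ∈ Finset.univ.filter (fun a : Fin N => (a : ℕ) < k), ∏ b ∈ Finset.Ioi a, (y a - y b)) *
        Matrix.det (Matrix.of fun i j : Fin N => e i (min k j) j) := by
    intro k
    induction k with
    | zero => intro _; simp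
    | succ k ih =>
      intro hk
      rw [ih (by omega)]
      set c : Fin N := ⟨k, hk⟩ with hc
      have hfil : (Finset.univ.filter fun a : Fin N => (a : ℕ) < k + 1) =
          insert c (Finset.univ.filter fun a : Fin N => (a : ℕ) < k) := by
        ext a
        simp [hc, Fin.ext_iff]
        omega
      rw [hfil, Finset.prod_insert (by simp [hc]), mul_comm (∏ b ∈ Finset.Ioi c, _), mul_assoc]
      congr 1
      have hv : ∏ b ∈ Finset.Ioi c, (y c - y b) =
          ∏ b : Fin N, (if c < b then y c - y b else 1) := by
        rw [← Finset.prod_filter]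
        refine Finset.prod_congr ?_ fun _ _ => rfl
        ext b; simp
      rw [hv, ← Matrix.det_mul_row, ← Matrix.det_transpose, ← Matrix.det_transpose (Matrix.of _)]
      refine Matrix.det_eq_of_forall_row_eq_smul_add_const
        (fun j => if c < j then 1 else 0) c (by simp) ?_
      intro j i
      simp only [Matrix.transpose_apply, Matrix.of_apply, lt_irrefl, if_false, one_mul]
      have hcv : (c : ℕ) = k := rfl
      have h2 : min (k + 1) (c : ℕ) = k := by omega
      rw [h2]
      by_cases hj : c < j
      · have h1 : min k (j : ℕ) = k := by have := Fin.lt_def.mp hj; omega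
        have h3 : min (k + 1) (j : ℕ) = k + 1 := by have := Fin.lt_def.mp hj; omega
        rw [h1, h3, if_pos hj, if_pos hj]
        have := h i c j hj
        rw [hcv] at this
        linear_combination -this
      · have h1 : min k (j : ℕ) = j := by rw [Fin.lt_def] at hj; omega
        have h3 : min (k + 1) (j : ℕ) = j := by rw [Fin.lt_def] at hj; omega
        rw [h1, h3, if_neg hj, if_neg hj]
        ring
  have := key N le_rfl
  rw [mul_comm] at this
  rw [show Finset.univ.filter (fun a : Fin N => (a : ℕ) < N) = Finset.univ by ext a; simp] at this
  exact ⟨_, this⟩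

theorem det_monic {A : Type} [CommRing A] (y : Fin N → A) (f : ℕ → A[X])
    (hf : ∀ n, (f n).Monic ∧ (f n).natDegree = n) :
    Matrix.det (Matrix.of fun i j : Fin N => (f (Fin.rev i : ℕ)).eval (y j)) =
      ∏ a : Fin N, ∏ b ∈ Finset.Ioi a, (y a - y b) := by
  have h1 := Matrix.det_eval_matrixOfPolynomials_eq_det_vandermonde (fun i => y (Fin.rev i))
    (fun i : Fin N => f i) (fun i => (hf i).2) (fun i => (hf i).1)
  rw [← Matrix.det_submatrix_equiv_self Fin.revPerm, ← Matrix.det_transpose]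
  have h2 : ((Matrix.of fun i j : Fin N => (f (Fin.rev i : ℕ)).eval (y j)).submatrix
      Fin.revPerm Fin.revPerm).transpose =
      Matrix.of fun i j : Fin N => (f j).eval (y (Fin.rev i)) := by
    ext i j
    simp [Fin.revPerm, -Fin.val_rev]
  rw [h2, ← h1, Matrix.det_vandermonde]
  have h3 : ∀ F : Fin N → Fin N → A, ∏ a, ∏ b ∈ Finset.Ioi a, F a b =
      ∏ a, ∏ b, if a < b then F a b else 1 := by
    intro F
    refine Finset.prod_congr rfl fun a _ => ?_
    rw [← Finset.prod_filter]
    refine Finset.prod_congr ?_ fun _ _ => rfl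
    ext b; simp
  rw [h3, h3, Finset.prod_comm, ← Equiv.prod_comp Fin.revPerm]
  refine Finset.prod_congr rfl fun a _ => ?_
  rw [← Equiv.prod_comp Fin.revPerm]
  refine Finset.prod_congr rfl fun b _ => ?_
  simp [Fin.revPerm]

theorem exactQuot_mul {A : Type} [CommRing A] {a b : A} (h : ∃ q, q * b = a) :
    exactQuot a b * b = a :=
  Classical.epsilon_spec h

theorem exactQuot_unique {A : Type} [CommRing A] {a b q : A} (hb : b ∈ nonZeroDivisors A)
    (h : q * b = a) : exactQuot a b = q :=
  (mul_cancel_right_mem_nonZeroDivisors hb).mp ((exactQuot_mul ⟨q, h⟩).trans h.symm)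

/-- Iterated quotients in Newton interpolation, up to sign. -/
noncomputable def newtonQuot {A : Type} [CommRing A] (y : Fin N → A) (f : A[X]) : ℕ → A[X]
  | 0 => f
  | k + 1 => if h : k < N then -(newtonQuot y f k /ₘ (X - C (y ⟨k, h⟩))) else 0

theorem alternantPoly_zero (f : ℕ → ℂ[X]) (hf : ∀ n, (f n).Monic ∧ (f n).natDegree = n) :
    alternantPoly (N := N) f 0 = ∏ a : Fin N, ∏ b ∈ Finset.Ioi a,
      (MvPolynomial.X a - MvPolynomial.X b) := by
  rw [← det_monic _ (fun n => (f n).map (algebraMap ℂ (MvPolynomial (Fin N) ℂ)))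
    (fun n => ⟨(hf n).1.map _, by rw [(hf n).1.natDegree_map, (hf n).2]⟩)]
  simp [alternantPoly, eval_map, aeval_def]

theorem alternantPoly_zero_mem (f : ℕ → ℂ[X]) (hf : ∀ n, (f n).Monic ∧ (f n).natDegree = n) :
    alternantPoly (N := N) f 0 ∈ nonZeroDivisors _ := by
  rw [alternantPoly_zero f hf]
  refine prod_mem fun a _ => prod_mem fun b hb => mem_nonZeroDivisors_of_ne_zero ?_
  rw [sub_ne_zero]
  intro h
  exact (Finset.mem_Ioi.mp hb).ne (MvPolynomial.X_injective h)

theorem exists_alternantPoly (f : ℕ → ℂ[X]) (hf : ∀ n, (f n).Monic ∧ (f n).natDegree = n)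
    (l : Fin N → ℕ) : ∃ q, q * alternantPoly f 0 = alternantPoly f l := by
  rw [alternantPoly_zero f hf]
  obtain ⟨q, hq⟩ := det_dividedDifferences (fun j => (MvPolynomial.X j : MvPolynomial (Fin N) ℂ))
    (fun i k j => (newtonQuot (fun j => (MvPolynomial.X j : MvPolynomial (Fin N) ℂ))
      ((f (l i + (Fin.rev i : ℕ))).map (algebraMap ℂ _)) k).eval (MvPolynomial.X j)) (by
      intro i k j _
      rw [newtonQuot, dif_pos k.2]
      set g := newtonQuot (fun j => (MvPolynomial.X j : MvPolynomial (Fin N) ℂ))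
        ((f (l i + (Fin.rev i : ℕ))).map (algebraMap ℂ _)) k
      have h := congrArg (eval (MvPolynomial.X j : MvPolynomial (Fin N) ℂ))
        (modByMonic_add_div g (X - C (MvPolynomial.X k : MvPolynomial (Fin N) ℂ)))
      rw [modByMonic_X_sub_C_eq_C_eval] at h
      simp only [eval_add, eval_C, eval_mul, eval_sub, eval_X] at h
      simp only [Fin.eta, eval_neg]
      linear_combination h)
  refine ⟨q, hq.symm.trans ?_⟩
  simp [alternantPoly, newtonQuot, eval_map, aeval_def]

theorem coeff_mul_yVar (g : MvLaurentAtInfty N ℂ) (j : Fin N) (n : Fin N → ℤ) :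
    (g * yVar ℂ j).coeff n = g.coeff (n + Pi.single j 1) := by
  rw [yVar, HahnSeries.coeff_mul_single, mul_one]
  congr 1
  ext i
  by_cases h : i = j
  · subst h; simp
  · simp [h]

theorem yVar_sub_mem {a b : Fin N} (hab : a ≠ b) :
    (yVar ℂ a - yVar ℂ b : MvLaurentAtInfty N ℂ) ∈ nonZeroDivisors (MvLaurentAtInfty N ℂ) := by
  rw [mem_nonZeroDivisors_iff_right]
  intro g hg
  have h1 : ∀ n : Fin N → ℤ, g.coeff (n + Pi.single a 1) = g.coeff (n + Pi.single b 1) := by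
    intro n
    have := congrArg (fun x : MvLaurentAtInfty N ℂ => x.coeff n) hg
    simp only [mul_sub, HahnSeries.coeff_sub, coeff_mul_yVar, HahnSeries.coeff_zero] at this
    exact sub_eq_zero.mp this
  ext n
  rw [HahnSeries.coeff_zero]
  by_contra hn
  have h2 : ∀ m : ℕ, n + (m : ℤ) • (Pi.single a 1 - Pi.single b 1 : Fin N → ℤ) ∈ g.support := by
    intro m
    induction m with
    | zero => simpa using hn
    | succ m ih =>
      rw [HahnSeries.mem_support] at ih ⊢
      have := h1 (n + (m : ℤ) • (Pi.single a 1 - Pi.single b 1 : Fin N → ℤ) - Pi.single b 1)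
      rw [sub_add_cancel] at this
      rw [← this] at ih
      convert ih using 2
      push_cast
      rw [add_smul, one_smul]
      abel
  obtain ⟨c, hc⟩ := (isPWO_iff_bddBelow _).mp g.isPWO_support
  have h3 := hc (h2 (n b - c b + 1).toNat) b
  have h4 : n b - c b + 1 ≤ ((n b - c b + 1).toNat : ℤ) := Int.self_le_toNat _
  simp only [Pi.add_apply, Pi.smul_apply, Pi.sub_apply, Pi.single_eq_same,
    Pi.single_eq_of_ne (Ne.symm hab), smul_eq_mul] at h3
  linarith

/-- The divided difference of `f` at `y_1, …, y_k, y_j`, up to sign. -/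
noncomputable def laurentDD (f : LaurentAtInfty) (k : ℕ) (j : Fin N) : MvLaurentAtInfty N ℂ where
  coeff n := open Classical in
    if ∀ i : Fin N, k ≤ i ∧ i ≠ j → n i = 0 then
      f.coeff (∑ i, n i - k) *
        ((if ∀ i : Fin N, i < k ∨ i = j → n i ≤ 0 then (-1) ^ k else 0) +
          (if ∀ i : Fin N, i < k ∨ i = j → 0 < n i then 1 else 0))
    else 0
  isPWO_support' := by
    rw [isPWO_iff_bddBelow]
    refine ⟨fun _ => min 0 (f.order + k), fun n hn i => ?_⟩
    rw [Function.mem_support] at hn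
    split_ifs at hn with h0 h1 h2 h2
    · exfalso
      have := h1 j (Or.inr rfl)
      have := h2 j (Or.inr rfl)
      omega
    · have hle : ∀ i, n i ≤ 0 := by
        intro i
        by_cases hi : (i : ℕ) < k ∨ i = j
        · exact h1 i hi
        · push Not at hi
          exact (h0 i hi).le
      have hf : f.order ≤ ∑ i, n i - k := by
        by_contra hlt
        rw [HahnSeries.coeff_eq_zero_of_lt_order (not_le.mp hlt), zero_mul] at hn
        exact hn rfl
      have hs := Finset.add_sum_erase Finset.univ n (Finset.mem_univ i)
      have hs' : ∑ x ∈ Finset.univ.erase i, n x ≤ 0 := Finset.sum_nonpos fun x _ => hle x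
      have h3 : f.order + (k : ℤ) ≤ n i := by omega
      exact (min_le_right _ _).trans h3
    · refine (min_le_left _ _).trans ?_
      by_cases hi : (i : ℕ) < k ∨ i = j
      · exact (h2 i hi).le
      · push Not at hi
        exact (h0 i hi).ge
    · simp at hn
    · exact absurd rfl hn

theorem laurentDD_zero (f : LaurentAtInfty) (j : Fin N) : laurentDD f 0 j = evalAt j f := by
  ext n
  by_cases h : ∃ m : ℤ, n = Pi.single j m
  · obtain ⟨m, rfl⟩ := h
    have h1 : (evalAt j f).coeff (Pi.single j m) = f.coeff m :=
      HahnSeries.embDomain_coeff (a := m)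
    rw [h1, laurentDD]
    have h2 : ∀ i : Fin N, 0 ≤ (i : ℕ) ∧ i ≠ j → (Pi.single j m : Fin N → ℤ) i = 0 := by
      intro i hi; simp [hi.2]
    dsimp only
    rw [if_pos h2]
    rcases le_or_gt m 0 with hm | hm
    · simp [hm, not_lt.mpr hm]
    · simp [hm, not_le.mpr hm]
  · have h1 : (evalAt j f).coeff n = 0 := by
      refine HahnSeries.embDomain_of_notMem_range ?_
      rintro ⟨m, hm⟩
      exact h ⟨m, hm.symm⟩
    rw [h1, laurentDD]
    simp only
    rw [if_neg]
    intro h2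
    apply h
    refine ⟨n j, ?_⟩
    ext i
    by_cases hi : i = j
    · subst hi; simp
    · rw [Pi.single_eq_of_ne hi]; exact h2 i ⟨Nat.zero_le _, hi⟩

open Classical in
theorem laurentDD_succ_aux (Z P1 P2 : Prop) (a b : ℤ) (c F : ℂ) :
    ((if Z then F * ((if P1 ∧ a + 1 ≤ 0 ∧ b ≤ 0 then -c else 0) +
        (if P2 ∧ 0 < a + 1 ∧ 0 < b then 1 else 0)) else 0) -
      if Z then F * ((if P1 ∧ a ≤ 0 ∧ b + 1 ≤ 0 then -c else 0) +
        (if P2 ∧ 0 < a ∧ 0 < b + 1 then 1 else 0)) else 0) =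
    (if Z ∧ a = 0 then F * ((if P1 ∧ b ≤ 0 then c else 0) +
        (if P2 ∧ 0 < b then 1 else 0)) else 0) -
      if Z ∧ b = 0 then F * ((if P1 ∧ a ≤ 0 then c else 0) +
        (if P2 ∧ 0 < a then 1 else 0)) else 0 := by
  have q1 : (a + 1 ≤ 0) ↔ a < 0 := by omega
  have q2 : (b + 1 ≤ 0) ↔ b < 0 := by omega
  have q3 : (0 < a + 1) ↔ 0 ≤ a := by omega
  have q4 : (0 < b + 1) ↔ 0 ≤ b := by omega
  simp only [q1, q2, q3, q4]
  by_cases hZ : Z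
  swap
  · simp [hZ]
  have t : ∀ x : ℤ,
      ((x < 0 ↔ True) ∧ (x ≤ 0 ↔ True) ∧ (0 ≤ x ↔ False) ∧ (0 < x ↔ False) ∧ (x = 0 ↔ False)) ∨
      ((x < 0 ↔ False) ∧ (x ≤ 0 ↔ True) ∧ (0 ≤ x ↔ True) ∧ (0 < x ↔ False) ∧ (x = 0 ↔ True)) ∨
      ((x < 0 ↔ False) ∧ (x ≤ 0 ↔ False) ∧ (0 ≤ x ↔ True) ∧ (0 < x ↔ True) ∧ (x = 0 ↔ False)) := by
    intro x
    rcases lt_trichotomy x 0 with hx | hx | hx <;> simp <;> omega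
  rcases t a with ⟨a1, a2, a3, a4, a5⟩ | ⟨a1, a2, a3, a4, a5⟩ | ⟨a1, a2, a3, a4, a5⟩ <;>
    rcases t b with ⟨b1, b2, b3, b4, b5⟩ | ⟨b1, b2, b3, b4, b5⟩ | ⟨b1, b2, b3, b4, b5⟩ <;>
    simp only [hZ, a1, a2, a3, a4, a5, b1, b2, b3, b4, b5, and_true, and_false,
      if_true, if_false] <;>
    by_cases hP1 : P1 <;> by_cases hP2 : P2 <;> simp [hP1, hP2]

theorem laurentDD_succ (f : LaurentAtInfty) (k j : Fin N) (hkj : k < j) :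
    laurentDD f (k + 1) j * (yVar ℂ k - yVar ℂ j) = laurentDD f k j - laurentDD f k k := by
  classical
  ext n
  rw [mul_sub, HahnSeries.coeff_sub, HahnSeries.coeff_sub, coeff_mul_yVar, coeff_mul_yVar]
  have hkj' : (k : ℕ) < j := hkj
  have hne : k ≠ j := hkj.ne
  have e1 : ∀ c : Fin N, ∑ i, (n + Pi.single c 1 : Fin N → ℤ) i - ((k + 1 : ℕ) : ℤ)
      = ∑ i, n i - (k : ℕ) := by
    intro c
    simp [Finset.sum_add_distrib]
  have s1 : ∀ (c i : Fin N), i ≠ c → (n + Pi.single c 1 : Fin N → ℤ) i = n i := by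
    intro c i h; simp [h]
  have s2 : ∀ c : Fin N, (n + Pi.single c 1 : Fin N → ℤ) c = n c + 1 := by intro c; simp
  have z1 : ∀ c : Fin N, c = k ∨ c = j →
      ((∀ i : Fin N, (k : ℕ) + 1 ≤ i ∧ i ≠ j → (n + Pi.single c 1 : Fin N → ℤ) i = 0) ↔
        ∀ i : Fin N, (k : ℕ) + 1 ≤ i ∧ i ≠ j → n i = 0) := by
    intro c hc
    refine forall_congr' fun i => imp_congr_right fun hi => ?_
    rw [s1 c i]
    rintro rfl
    rcases hc with rfl | rfl
    · omega
    · exact hi.2 rfl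
  have z2 : (∀ i : Fin N, (k : ℕ) ≤ i ∧ i ≠ j → n i = 0) ↔
      (∀ i : Fin N, (k : ℕ) + 1 ≤ i ∧ i ≠ j → n i = 0) ∧ n k = 0 := by
    refine ⟨fun h => ⟨fun i hi => h i ⟨by omega, hi.2⟩, h k ⟨le_rfl, hne⟩⟩, fun h i hi => ?_⟩
    by_cases hik : i = k
    · rw [hik]; exact h.2
    · exact h.1 i ⟨by have := Fin.val_ne_of_ne hik; omega, hi.2⟩
  have z3 : (∀ i : Fin N, (k : ℕ) ≤ i ∧ i ≠ k → n i = 0) ↔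
      (∀ i : Fin N, (k : ℕ) + 1 ≤ i ∧ i ≠ j → n i = 0) ∧ n j = 0 := by
    refine ⟨fun h => ⟨fun i hi => h i ⟨by omega, ?_⟩, h j ⟨hkj'.le, hne.symm⟩⟩, fun h i hi => ?_⟩
    · rintro rfl; omega
    · by_cases hij : i = j
      · rw [hij]; exact h.2
      · exact h.1 i ⟨by have := Fin.val_ne_of_ne hi.2; omega, hij⟩
  have sg : ∀ (R : ℤ → Prop) (m : Fin N → ℤ), (∀ i : Fin N, (i : ℕ) < k → m i = n i) →
      ((∀ i : Fin N, (i : ℕ) < k + 1 ∨ i = j → R (m i)) ↔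
        (∀ i : Fin N, (i : ℕ) < k → R (n i)) ∧ R (m k) ∧ R (m j)) := by
    intro R m hm
    refine ⟨fun h => ⟨fun i hi => hm i hi ▸ h i (Or.inl (by omega)), h k (Or.inl (by omega)),
      h j (Or.inr rfl)⟩, ?_⟩
    rintro ⟨h1, h2, h3⟩ i (hi | rfl)
    · by_cases hik : i = k
      · rw [hik]; exact h2
      · have : (i : ℕ) < k := by have := Fin.val_ne_of_ne hik; omega
        rw [hm i this]; exact h1 i this
    · exact h3
  have sh : ∀ (R : ℤ → Prop) (c : Fin N),
      ((∀ i : Fin N, (i : ℕ) < k ∨ i = c → R (n i)) ↔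
        (∀ i : Fin N, (i : ℕ) < k → R (n i)) ∧ R (n c)) := by
    intro R c
    refine ⟨fun h => ⟨fun i hi => h i (Or.inl hi), h c (Or.inr rfl)⟩, ?_⟩
    rintro ⟨h1, h2⟩ i (hi | rfl)
    exacts [h1 i hi, h2]
  have hlow : ∀ c : Fin N, c = k ∨ c = j → ∀ i : Fin N, (i : ℕ) < k →
      (n + Pi.single c 1 : Fin N → ℤ) i = n i := by
    intro c hc i hi
    apply s1
    rintro rfl
    rcases hc with rfl | rfl <;> omega
  simp only [laurentDD, e1, z1 k (Or.inl rfl), z1 j (Or.inr rfl), z2, z3,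
    sg (fun x => x ≤ 0) _ (hlow k (Or.inl rfl)), sg (fun x => x ≤ 0) _ (hlow j (Or.inr rfl)),
    sg (fun x => 0 < x) _ (hlow k (Or.inl rfl)), sg (fun x => 0 < x) _ (hlow j (Or.inr rfl)),
    sh (fun x => x ≤ 0), sh (fun x => 0 < x), s2, s1 k j hne.symm, s1 j k hne]
  have hpow : (-1 : ℂ) ^ ((k : ℕ) + 1) = -(-1) ^ (k : ℕ) := by ring
  simp only [hpow]
  convert laurentDD_succ_aux (∀ i : Fin N, (k : ℕ) + 1 ≤ i ∧ i ≠ j → n i = 0)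
    (∀ i : Fin N, (i : ℕ) < k → n i ≤ 0) (∀ i : Fin N, (i : ℕ) < k → 0 < n i) (n k) (n j)
    ((-1) ^ (k : ℕ)) (f.coeff (∑ i, n i - (k : ℕ)))

theorem evalAt_ofPoly (j : Fin N) (f : ℂ[X]) :
    evalAt j (DeltaOperator.ofPoly f) = (f.map HahnSeries.C).eval (yVar ℂ j) := by
  rw [DeltaOperator.ofPoly, coe_eval₂RingHom, hom_eval₂, eval_map]
  congr 1
  · ext c : 1
    exact HahnSeries.embDomainRingHom_C
  · exact HahnSeries.embDomain_single

theorem alternant_zero (f : ℤ → LaurentAtInfty) (g : ℕ → ℂ[X]) (hfg : ∀ n : ℕ, f n = DeltaOperator.ofPoly (g n))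
    (hg : ∀ n, (g n).Monic ∧ (g n).natDegree = n) :
    alternant (N := N) f 0 = ∏ a : Fin N, ∏ b ∈ Finset.Ioi a, (yVar ℂ a - yVar ℂ b) := by
  rw [← det_monic _ (fun n => (g n).map (HahnSeries.C : ℂ →+* MvLaurentAtInfty N ℂ))
    (fun n => ⟨(hg n).1.map _, by rw [(hg n).1.natDegree_map, (hg n).2]⟩)]
  simp [alternant, hfg, evalAt_ofPoly, -Fin.val_rev]

theorem alternant_zero_mem (f : ℤ → LaurentAtInfty) (g : ℕ → ℂ[X])
    (hfg : ∀ n : ℕ, f n = DeltaOperator.ofPoly (g n)) (hg : ∀ n, (g n).Monic ∧ (g n).natDegree = n) :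
    alternant (N := N) f 0 ∈ nonZeroDivisors _ := by
  rw [alternant_zero f g hfg hg]
  exact prod_mem fun a _ => prod_mem fun b hb => yVar_sub_mem (Finset.mem_Ioi.mp hb).ne

theorem exists_alternant (f : ℤ → LaurentAtInfty) (g : ℕ → ℂ[X])
    (hfg : ∀ n : ℕ, f n = DeltaOperator.ofPoly (g n)) (hg : ∀ n, (g n).Monic ∧ (g n).natDegree = n)
    (l : Fin N → ℤ) : ∃ q, q * alternant f 0 = alternant f l := by
  rw [alternant_zero f g hfg hg]
  obtain ⟨q, hq⟩ := det_dividedDifferences (fun j : Fin N => yVar ℂ j)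
    (fun i k j => laurentDD (f (l i + ((Fin.rev i : ℕ) : ℤ))) k j)
    (fun i k j hkj => laurentDD_succ _ k j hkj)
  refine ⟨q, hq.symm.trans ?_⟩
  simp [alternant, laurentDD_zero]

end Quotients

namespace DeltaOperator

variable (Q : DeltaOperator)

/-- The Schur type function `s_λ ∈ ℂ((y₁⁻¹, …, y_N⁻¹))`, `λ ∈ ℤ ^ N`. -/
noncomputable def schur {N : ℕ} (l : Fin N → ℤ) : MvLaurentAtInfty N ℂ :=
  exactQuot (alternant Q.p l) (alternant Q.p 0)

/-- The Schur type function `s*_λ ∈ ℂ((y₁⁻¹, …, y_N⁻¹))`, `λ ∈ ℤ ^ N`. -/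
noncomputable def schurStar {N : ℕ} (l : Fin N → ℤ) : MvLaurentAtInfty N ℂ :=
  exactQuot (alternant Q.pStar l) (alternant Q.pStar 0)

/-- The polynomial `s_λ` for `λ` with nonnegative entries. -/
noncomputable def schurPoly {N : ℕ} (l : Fin N → ℕ) : MvPolynomial (Fin N) ℂ :=
  exactQuot (alternantPoly Q.basic l) (alternantPoly Q.basic 0)

/-- The polynomial `s*_λ` for `λ` with nonnegative entries. -/
noncomputable def schurStarPoly {N : ℕ} (l : Fin N → ℕ) : MvPolynomial (Fin N) ℂ :=
  exactQuot (alternantPoly Q.basicStar l) (alternantPoly Q.basicStar 0)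

end DeltaOperator


namespace DeltaOperator

variable (Q : DeltaOperator) {N : ℕ}

/-! The quotients above exist and are unique for normalized `Q`. -/

theorem schur_mul (hQ : Q.IsNormalized) (l : Fin N → ℤ) :
    Q.schur l * alternant Q.p 0 = alternant Q.p l :=
  exactQuot_mul (exists_alternant _ Q.basic (fun _ => rfl) (Q.basic_monic hQ) l)

theorem schurStar_mul (hQ : Q.IsNormalized) (l : Fin N → ℤ) :
    Q.schurStar l * alternant Q.pStar 0 = alternant Q.pStar l :=
  exactQuot_mul (exists_alternant _ Q.basicStar (fun _ => rfl) (Q.basicStar_monic hQ) l)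

theorem schurPoly_mul (hQ : Q.IsNormalized) (l : Fin N → ℕ) :
    Q.schurPoly l * alternantPoly Q.basic 0 = alternantPoly Q.basic l :=
  exactQuot_mul (exists_alternantPoly _ (Q.basic_monic hQ) l)

theorem schurStarPoly_mul (hQ : Q.IsNormalized) (l : Fin N → ℕ) :
    Q.schurStarPoly l * alternantPoly Q.basicStar 0 = alternantPoly Q.basicStar l :=
  exactQuot_mul (exists_alternantPoly _ (Q.basicStar_monic hQ) l)

theorem schur_unique (hQ : Q.IsNormalized) {l : Fin N → ℤ} {q : MvLaurentAtInfty N ℂ}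
    (h : q * alternant Q.p 0 = alternant Q.p l) : Q.schur l = q :=
  exactQuot_unique (alternant_zero_mem _ Q.basic (fun _ => rfl) (Q.basic_monic hQ)) h

theorem schurStar_unique (hQ : Q.IsNormalized) {l : Fin N → ℤ} {q : MvLaurentAtInfty N ℂ}
    (h : q * alternant Q.pStar 0 = alternant Q.pStar l) : Q.schurStar l = q :=
  exactQuot_unique (alternant_zero_mem _ Q.basicStar (fun _ => rfl) (Q.basicStar_monic hQ)) h

theorem schurPoly_unique (hQ : Q.IsNormalized) {l : Fin N → ℕ} {q : MvPolynomial (Fin N) ℂ}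
    (h : q * alternantPoly Q.basic 0 = alternantPoly Q.basic l) : Q.schurPoly l = q :=
  exactQuot_unique (alternantPoly_zero_mem _ (Q.basic_monic hQ)) h

theorem schurStarPoly_unique (hQ : Q.IsNormalized) {l : Fin N → ℕ} {q : MvPolynomial (Fin N) ℂ}
    (h : q * alternantPoly Q.basicStar 0 = alternantPoly Q.basicStar l) : Q.schurStarPoly l = q :=
  exactQuot_unique (alternantPoly_zero_mem _ (Q.basicStar_monic hQ)) h

/-- The inclusion `ℂ[y] → ℂ((y⁻¹))` maps the polynomial `s_λ` to `s_λ`. -/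
theorem eval₂_schurPoly (hQ : Q.IsNormalized) (l : Fin N → ℕ) :
    MvPolynomial.eval₂Hom HahnSeries.C (yVar ℂ) (Q.schurPoly l) = Q.schur fun i => (l i : ℤ) := by
  symm
  apply Q.schur_unique hQ
  have h : ∀ m : Fin N → ℕ, MvPolynomial.eval₂Hom HahnSeries.C (yVar ℂ)
      (alternantPoly Q.basic m) = alternant Q.p fun i => (m i : ℤ) := by
    intro m
    rw [alternantPoly, alternant, RingHom.map_det]
    congr 1
    ext1 i j
    change _ = evalAt j (ofPoly (Q.basic (m i + (Fin.rev i : ℕ))))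
    rw [evalAt_ofPoly, RingHom.mapMatrix_apply, Matrix.map_apply, Matrix.of_apply, aeval_def,
      hom_eval₂, eval_map]
    congr 1
    · ext c : 1; simp [MvPolynomial.algebraMap_eq]
    · simp
  have h0 := h 0
  simp only [Pi.zero_apply, Nat.cast_zero] at h0
  rw [← h l, ← Q.schurPoly_mul hQ l, map_mul, h0]
  rfl

/-- The inclusion `ℂ[y] → ℂ((y⁻¹))` maps the polynomial `s*_λ` to `s*_λ`. -/
theorem eval₂_schurStarPoly (hQ : Q.IsNormalized) (l : Fin N → ℕ) :
    MvPolynomial.eval₂Hom HahnSeries.C (yVar ℂ) (Q.schurStarPoly l) =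
      Q.schurStar fun i => (l i : ℤ) := by
  symm
  apply Q.schurStar_unique hQ
  have h : ∀ m : Fin N → ℕ, MvPolynomial.eval₂Hom HahnSeries.C (yVar ℂ)
      (alternantPoly Q.basicStar m) = alternant Q.pStar fun i => (m i : ℤ) := by
    intro m
    rw [alternantPoly, alternant, RingHom.map_det]
    congr 1
    ext1 i j
    change _ = evalAt j (ofPoly (Q.basicStar (m i + (Fin.rev i : ℕ))))
    rw [evalAt_ofPoly, RingHom.mapMatrix_apply, Matrix.map_apply, Matrix.of_apply, aeval_def,
      hom_eval₂, eval_map]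
    congr 1
    · ext c : 1; simp [MvPolynomial.algebraMap_eq]
    · simp
  have h0 := h 0
  simp only [Pi.zero_apply, Nat.cast_zero] at h0
  rw [← h l, ← Q.schurStarPoly_mul hQ l, map_mul, h0]
  rfl

end DeltaOperator

/-- Young diagrams of depth (number of rows) at most `d`. -/
abbrev DiagramOfDepthLE (d : ℕ) : Type := {l : YoungDiagram // l.colLen 0 ≤ d}

/-- `λ‡ = (-M - λ_N, -M - λ_{N-1}, …, -M - λ_1) ∈ ℤ ^ N`, where `λ_i = 0` beyond the depth. -/
def ddagger (M : ℕ) {N : ℕ} (l : YoungDiagram) : Fin N → ℤ :=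
  fun j => -(M : ℤ) - (l.rowLen (Fin.rev j : ℕ) : ℤ)

/-- The inclusion `ℂ((y⁻¹)) → ℂ[x]((y⁻¹))`. -/
noncomputable def liftCoeffs (M : ℕ) {N : ℕ} (f : MvLaurentAtInfty N ℂ) :
    MvLaurentAtInfty N (MvPolynomial (Fin M) ℂ) :=
  HahnSeries.map f (MvPolynomial.C : ℂ →+* MvPolynomial (Fin M) ℂ)

/-- `F = ∑_a f_a` as formal series: all exponents of all `f_a` lie in one set of exponents that is
bounded above, every monomial occurs in only finitely many `f_a`, and every coefficient of `F` is
the sum of the corresponding coefficients of the `f_a`. -/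
def HasFormalSum {α : Type} {N : ℕ} {R : Type} [CommRing R] (f : α → MvLaurentAtInfty N R)
    (F : MvLaurentAtInfty N R) : Prop :=
  ∃ S : HahnSeries.SummableFamily (Fin N → ℤ) R α, (∀ a, S a = f a) ∧ S.hsum = F

end SchurType

open SchurType

/-! The identity follows from the determinant formula of Cauchy and a Cauchy–Binet expansion.

Let `f = p*`, `F = p` or `f = p`, `F = p*`. In both cases there is a one-variable expansion
`1 / (y + x) = ∑_n (-1) ^ n f_n(x) F_{-1-n}(y)`, and `F_{-1-n}` has degree at most `-1-n`; such a
pair is called a Cauchy pair (`IsCauchyPair`). For `f = p` the expansion is dual to the Taylor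
expansion of a polynomial in the basic polynomials (`DeltaOperator.sum_taylor`), as `Q` on
`ℂ((x⁻¹))` is adjoint to `Q` on `ℂ[x]` for a residue pairing
(`DeltaOperator.residuePairing_onLaurent`); the case `f = p*` follows on division by `x`.

Let `M ≤ N` and `r = N - M`. The `N × N` determinant with rows `F_{r-1}(y), …, F_0(y)` and
`1 / (y + x_1), …, 1 / (y + x_M)` is the product of all `1 / (y_j + x_i)` and of the two
Vandermonde products in `x` and in `y` (`det_cauchy`). These products are the denominators of the
Schur type functions. When the expansions are inserted into the last `M` rows, the Cauchy–Binet
formula (`alternatingMap_sum_smul`) turns the determinant into a sum over strictly decreasing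
sequences `n_1 > ⋯ > n_M ≥ 0`, that is over diagrams with `n_i = λ_i + M - i`, of products of an
alternant in `x` and an alternant in `y`. If `M ≥ N`, the roles of `x` and `y` are exchanged, with
`r = M - N` polynomial rows `f_{r-1}(x), …, f_0(x)`; these absorb the terms `n < r` of the
expansions, so that `n_i = λ_i + M - i` again, for `i ≤ N`.

Convergence is measured by total degree in `y` (`filtration`). With the expansions cut off at
`n < K`, the Cauchy–Binet formula is a finite identity with an error of small total degree
(`IsCauchyPair.exists_partialSum_mem`), and a series is divisible by the denominators only with a
quotient of no larger degree (`mem_filtration_of_mul_prod`). So no infinite sum has to be multiplied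
or rearranged, and `hasFormalSum_of_filtration` concludes. -/

namespace SchurType

open Polynomial

/-! ### The residue pairing between `ℂ((x⁻¹))` and `ℂ[x]` -/

/-- The pairing of `ℂ((x⁻¹))` with `ℂ[x]` which sends `(f, x ^ m)` to `(-1) ^ m` times the
coefficient of `x ^ (-1-m)` in `f`, i.e. the residue of `f(x) g(-x)`. -/
noncomputable def residuePairing (f : LaurentAtInfty) : ℂ[X] →ₗ[ℂ] ℂ :=
  Polynomial.lsum fun m : ℕ => ((-1 : ℂ) ^ m * f.coeff (m + 1)) • LinearMap.id

theorem residuePairing_monomial (f : LaurentAtInfty) (m : ℕ) (a : ℂ) :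
    residuePairing f (monomial m a) = (-1) ^ m * f.coeff (m + 1) * a := by
  simp [residuePairing, Polynomial.lsum_apply]

theorem residuePairing_X_pow (f : LaurentAtInfty) (m : ℕ) :
    residuePairing f (X ^ m) = (-1) ^ m * f.coeff (m + 1) := by
  rw [X_pow_eq_monomial, residuePairing_monomial, mul_one]

theorem residuePairing_xDeriv (f : LaurentAtInfty) (g : ℂ[X]) :
    residuePairing (xDeriv f) g = residuePairing f (derivative g) := by
  induction g using Polynomial.induction_on' with
  | add p q hp hq => simp only [map_add, hp, hq]
  | monomial m a =>
    rw [derivative_monomial, residuePairing_monomial, residuePairing_monomial, coeff_xDeriv]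
    rcases m with _ | m
    · simp
    · have : ((m + 1 : ℕ) : ℤ) + 1 - 1 = (m : ℤ) + 1 := by push_cast; ring
      rw [this, Nat.add_sub_cancel]
      push_cast
      ring

theorem residuePairing_iterate_xDeriv (f : LaurentAtInfty) (k : ℕ) (g : ℂ[X]) :
    residuePairing (xDeriv^[k] f) g = residuePairing f (derivative^[k] g) := by
  induction k generalizing g with
  | zero => rfl
  | succ k ih =>
    rw [Function.iterate_succ_apply', residuePairing_xDeriv, ih, ← Function.iterate_succ_apply]

namespace DeltaOperator

variable (Q : DeltaOperator)

/-- `Q` on `ℂ((x⁻¹))` is adjoint to `Q` on `ℂ[x]`. -/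
theorem residuePairing_onLaurent (f : LaurentAtInfty) (g : ℂ[X]) :
    residuePairing (Q.onLaurent f) g = residuePairing f (Q.toLin g) := by
  have key : ∀ m : ℕ, residuePairing (Q.onLaurent f) (X ^ m) =
      residuePairing f (Q.toLin (X ^ m)) := by
    intro m
    rw [residuePairing_X_pow, coeff_onLaurent, Q.toLin_X_pow, map_sum,
      finsum_eq_sum_of_support_subset (s := Finset.range (m + 1)), Finset.mul_sum]
    · refine Finset.sum_congr rfl fun k _ => ?_
      rw [map_smul, ← residuePairing_iterate_xDeriv, residuePairing_X_pow, smul_eq_mul]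
      ring
    · intro k hk
      by_contra hkm
      apply hk
      have h0 := residuePairing_X_pow (xDeriv^[k] f) m
      rw [residuePairing_iterate_xDeriv, iterate_derivative_eq_zero (by simpa using hkm), map_zero]
        at h0
      have : (xDeriv^[k] f).coeff ((m : ℤ) + 1) = 0 := by
        rcases mul_eq_zero.mp h0.symm with h | h
        · simp at h
        · exact h
      simp [this]
  induction g using Polynomial.induction_on' with
  | add p q hp hq => simp only [map_add, hp, hq]
  | monomial m a => rw [← mul_one a, ← smul_eq_mul, ← smul_monomial, map_smul, map_smul, map_smul,
      ← X_pow_eq_monomial, key]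

theorem residuePairing_starNeg (k : ℕ) (g : ℂ[X]) :
    residuePairing (Q.starNeg k) g = (-1) ^ k / (k.factorial : ℂ) * ((Q.toLin^[k] g).eval 0) := by
  induction k generalizing g with
  | zero =>
    induction g using Polynomial.induction_on' with
    | add p q hp hq => simp only [map_add, hp, hq, Function.iterate_zero, id, eval_add]; ring
    | monomial m a =>
      rw [residuePairing_monomial, starNeg, HahnSeries.coeff_single]
      rcases m with _ | m
      · simp
      · have h : (m : ℤ) + 1 ≠ 0 := by omega
        simp [eval_monomial, h]
  | succ k ih =>
    have : ∀ (c : ℂ) (f : LaurentAtInfty), residuePairing (HahnSeries.C c * f) g =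
        c * residuePairing f g := by
      intro c f
      induction g using Polynomial.induction_on' with
      | add p q hp hq => simp only [map_add, hp, hq]; ring
      | monomial m a =>
        rw [residuePairing_monomial, residuePairing_monomial, HahnSeries.C_mul_eq_smul,
          HahnSeries.coeff_smul, smul_eq_mul]
        ring
    rw [starNeg, this, residuePairing_onLaurent, ih, ← Function.iterate_succ_apply,
      Nat.factorial_succ, pow_succ]
    have h1 : (-1 - k : ℂ) = -((k : ℂ) + 1) := by ring
    have h2 : (k : ℂ) + 1 ≠ 0 := by exact_mod_cast k.succ_ne_zero
    have h3 : (k.factorial : ℂ) ≠ 0 := by exact_mod_cast k.factorial_ne_zero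
    rw [h1]
    push_cast
    field_simp

theorem coeff_starNeg (k m : ℕ) : (Q.starNeg k).coeff (m + 1) =
    (-1) ^ m * ((-1) ^ k / (k.factorial : ℂ) * ((Q.toLin^[k] (X ^ m)).eval 0)) := by
  rw [← residuePairing_starNeg, residuePairing_X_pow, ← mul_assoc, ← mul_pow]
  simp

theorem iterate_toLin_eq_zero (k : ℕ) (g : ℂ[X]) (hg : g.degree < k) : Q.toLin^[k] g = 0 := by
  induction k generalizing g with
  | zero => simpa [Nat.WithBot.lt_zero_iff] using hg
  | succ k ih =>
    rw [Function.iterate_succ_apply]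
    apply ih
    by_cases h : 0 < g.degree
    · have h1 := Q.degree_map g h
      by_contra h2
      rw [not_lt] at h2
      have h3 : ((k : WithBot ℕ) + 1) ≤ (Q.toLin g).degree + 1 := by gcongr
      rw [h1] at h3
      push_cast at hg
      exact absurd hg (not_lt.mpr h3)
    · rw [eq_C_of_degree_le_zero (not_lt.mp h), Q.map_C, degree_zero]
      exact WithBot.bot_lt_coe k

theorem coeff_starNeg_nonpos (k : ℕ) {n : ℤ} (hn : n ≤ 0) : (Q.starNeg k).coeff n = 0 := by
  induction k generalizing n with
  | zero => exact HahnSeries.coeff_single_of_ne (by omega)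
  | succ k ih =>
    have h : ∀ i : ℕ, ∀ n : ℤ, n ≤ 0 → (xDeriv^[i] (Q.starNeg k)).coeff n = 0 := by
      intro i
      induction i with
      | zero => exact fun n hn => ih hn
      | succ i ih' =>
        intro n hn
        rw [Function.iterate_succ_apply', coeff_xDeriv, ih' _ (by omega), mul_zero]
    rw [starNeg, HahnSeries.C_mul_eq_smul, HahnSeries.coeff_smul, coeff_onLaurent,
      finsum_eq_zero_of_forall_eq_zero, smul_zero]
    intro i
    rw [h i n hn, mul_zero]

/-- `p*_{-1-k}` has degree at most `-1-k`. -/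
theorem coeff_starNeg_eq_zero (k : ℕ) {n : ℤ} (hn : n ≤ k) : (Q.starNeg k).coeff n = 0 := by
  rcases le_or_gt n 0 with h | h
  · exact Q.coeff_starNeg_nonpos k h
  · obtain ⟨m, rfl⟩ : ∃ m : ℕ, n = m + 1 := ⟨(n - 1).toNat, by omega⟩
    rw [coeff_starNeg, iterate_toLin_eq_zero]
    · simp
    · rw [degree_X_pow]
      exact_mod_cast (by omega : m < k)

/-- The functionals `g ↦ (Q ^ k g)(0) / k!` form the dual basis of the basic polynomials. -/
theorem iterate_toLin_basic (k n : ℕ) :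
    (Q.toLin^[k] (Q.basic n)).eval 0 = if k = n then (n.factorial : ℂ) else 0 := by
  induction k generalizing n with
  | zero =>
    rcases n with _ | n
    · simp [basic]
    · simp [(Q.basic_spec n).2]
  | succ k ih =>
    rw [Function.iterate_succ_apply]
    rcases n with _ | n
    · rw [basic, ← C_1, Q.map_C]
      simp [iterate_map_zero]
    · rw [(Q.basic_spec n).1]
      have : Q.toLin^[k] ((n + 1 : ℂ) • Q.basic n) = (n + 1 : ℂ) • Q.toLin^[k] (Q.basic n) := by
        rw [← Module.End.coe_pow, map_smul]
      rw [this, eval_smul, ih, Nat.factorial_succ]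
      split_ifs <;> simp_all

/-- A polynomial is determined by the values at `0` of its images under the powers of `Q`. -/
theorem eq_zero_of_iterate_toLin (m : ℕ) (g : ℂ[X]) (hm : Q.toLin^[m] g = 0)
    (h : ∀ k < m, (Q.toLin^[k] g).eval 0 = 0) : g = 0 := by
  induction m generalizing g with
  | zero => simpa using hm
  | succ m ih =>
    have h1 : Q.toLin g = 0 := by
      apply ih
      · rwa [← Function.iterate_succ_apply]
      · intro k hk
        rw [← Function.iterate_succ_apply]
        exact h (k + 1) (by omega)
    exact (Q.existsUnique_preimage 0).unique ⟨h1, h 0 (by omega)⟩ ⟨map_zero _, eval_zero⟩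

/-- The Taylor expansion of a polynomial in the basic polynomials. -/
theorem sum_taylor (K : ℕ) (g : ℂ[X]) (hg : g.degree < K) :
    ∑ n ∈ Finset.range K, ((Q.toLin^[n] g).eval 0 / (n.factorial : ℂ)) • Q.basic n = g := by
  rw [← sub_eq_zero]
  have hdeg : ∀ n, (Q.basic n).degree ≤ n := by
    intro n
    induction n with
    | zero => simp [basic]
    | succ n ih =>
      by_cases h : 0 < (Q.basic (n + 1)).degree
      · rw [← Q.degree_map _ h, (Q.basic_spec n).1]
        push_cast
        gcongr
        exact (degree_smul_le _ _).trans ih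
      · exact (not_lt.mp h).trans (by exact_mod_cast Nat.zero_le _)
  apply Q.eq_zero_of_iterate_toLin K
  · apply iterate_toLin_eq_zero
    refine (degree_sub_le _ _).trans_lt (max_lt ?_ hg)
    refine mem_degreeLT.mp (Submodule.sum_mem _ fun n hn => mem_degreeLT.mpr ?_)
    refine ((degree_smul_le _ _).trans (hdeg n)).trans_lt ?_
    exact_mod_cast Finset.mem_range.mp hn
  · intro k hk
    rw [← Module.End.coe_pow, map_sub, map_sum, eval_sub, eval_finsetSum,
      Finset.sum_eq_single_of_mem k (Finset.mem_range.mpr hk)]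
    · rw [map_smul, eval_smul, Module.End.coe_pow, iterate_toLin_basic, if_pos rfl, smul_eq_mul,
        div_mul_cancel₀ _ (by exact_mod_cast k.factorial_ne_zero), sub_self]
    · intro n _ hn
      rw [map_smul, eval_smul, Module.End.coe_pow, iterate_toLin_basic, if_neg hn.symm, smul_zero]

/-- The coefficient of `y ^ (-1-m)` in `1 / (y + x) = ∑ (-1) ^ n p_n(x) p*_{-1-n}(y)`. The
sum is finite as `p*_{-1-n}` has degree at most `-1-n`. -/
theorem sum_starNeg_basic (m K : ℕ) (h : m < K) :
    ∑ n ∈ Finset.range K, ((-1) ^ n * (Q.starNeg n).coeff (m + 1)) • Q.basic n = (-X) ^ m := by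
  have h1 := Q.sum_taylor K (X ^ m) (by rw [degree_X_pow]; exact_mod_cast h)
  rw [neg_pow]
  conv_rhs => rw [← h1]
  have h2 : ((-1 : ℂ[X])) ^ m = C ((-1) ^ m) := by simp
  rw [h2, ← smul_eq_C_mul, Finset.smul_sum]
  refine Finset.sum_congr rfl fun n _ => ?_
  rw [smul_smul, coeff_starNeg]
  congr 1
  have : ((-1 : ℂ) ^ n) * (-1) ^ n = 1 := by rw [← mul_pow]; simp
  linear_combination (-1) ^ m * (eval 0 ((⇑Q.toLin)^[n] (X ^ m)) / (n.factorial : ℂ)) * this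

/-- The coefficient of `y ^ (-1-m)` in `1 / (y + x) = ∑ (-1) ^ n p*_n(x) p_{-1-n}(y)`. After
multiplication by `x` this is `sum_starNeg_basic` for the next power of `y`, as `x p*_n = p_{n+1}`
and `p_{-1-n} = y p*_{-2-n}`. -/
theorem sum_starNeg_basicStar (m K : ℕ) (h : m < K) :
    ∑ n ∈ Finset.range K, ((-1) ^ n * (Q.starNeg (n + 1)).coeff (m + 2)) • Q.basicStar n =
      (-X) ^ m := by
  have h1 := Q.sum_starNeg_basic (m + 1) (K + 1) (by omega)
  have h0 : (Q.starNeg 0).coeff ((m + 1 : ℕ) + 1) = 0 :=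
    HahnSeries.coeff_single_of_ne (by push_cast; omega)
  rw [Finset.sum_range_succ', h0, mul_zero, zero_smul, add_zero] at h1
  apply mul_left_cancel₀ (X_ne_zero (R := ℂ))
  rw [Finset.mul_sum]
  trans -((-X) ^ (m + 1) : ℂ[X])
  swap
  · ring
  rw [← h1, ← Finset.sum_neg_distrib]
  refine Finset.sum_congr rfl fun n _ => ?_
  rw [mul_smul_comm, X_mul_basicStar, ← neg_smul]
  congr 1
  have : ((m + 1 : ℕ) : ℤ) + 1 = (m : ℤ) + 2 := by push_cast; ring
  rw [this]
  ring

end DeltaOperator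

/-! ### Cauchy pairs -/

/-- Polynomials `f_n` and Laurent series `F_n` which are monic polynomials for `n ≥ 0`, such that
`F_{-1-n}` has degree at most `-1-n` and `1 / (y + x) = ∑ (-1) ^ n f_n(x) F_{-1-n}(y)`. -/
structure IsCauchyPair (f : ℕ → ℂ[X]) (F : ℤ → LaurentAtInfty) : Prop where
  monic : ∀ n, (f n).Monic ∧ (f n).natDegree = n
  exists_poly : ∃ h : ℕ → ℂ[X], (∀ n : ℕ, F n = DeltaOperator.ofPoly (h n)) ∧
    ∀ n, (h n).Monic ∧ (h n).natDegree = n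
  coeff_eq_zero : ∀ (n : ℕ) (k : ℤ), k ≤ n → (F (-1 - n)).coeff k = 0
  sum_eq : ∀ m K : ℕ, m < K →
    ∑ n ∈ Finset.range K, ((-1) ^ n * (F (-1 - n)).coeff (m + 1)) • f n = (-X) ^ m

theorem neg_one_sub_natCast (n : ℕ) : (-1 - n : ℤ) = Int.negSucc n := by
  rw [Int.negSucc_eq]; ring

theorem isCauchyPair_basic (Q : DeltaOperator) (hQ : Q.IsNormalized) :
    IsCauchyPair Q.basic Q.pStar where
  monic := Q.basic_monic hQ
  exists_poly := ⟨Q.basicStar, fun _ => rfl, Q.basicStar_monic hQ⟩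
  coeff_eq_zero n k hk := by
    rw [neg_one_sub_natCast]
    exact Q.coeff_starNeg_eq_zero n hk
  sum_eq m K h := by
    simp only [neg_one_sub_natCast]
    exact Q.sum_starNeg_basic m K h

theorem isCauchyPair_basicStar (Q : DeltaOperator) (hQ : Q.IsNormalized) :
    IsCauchyPair Q.basicStar Q.p where
  monic := Q.basicStar_monic hQ
  exists_poly := ⟨Q.basic, fun _ => rfl, Q.basic_monic hQ⟩
  coeff_eq_zero n k hk := by
    rw [neg_one_sub_natCast, DeltaOperator.p, HahnSeries.coeff_single_mul, one_mul]
    exact Q.coeff_starNeg_eq_zero _ (by push_cast; omega)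
  sum_eq m K h := by
    rw [← Q.sum_starNeg_basicStar m K h]
    refine Finset.sum_congr rfl fun n _ => ?_
    rw [neg_one_sub_natCast, DeltaOperator.p, HahnSeries.coeff_single_mul, one_mul]
    congr 3

/-! ### The filtration of `R((y₁⁻¹, …, y_N⁻¹))` by total degree -/

section Filtration

variable {N : ℕ} {R : Type} [CommRing R]

/-- The series in `y₁, …, y_N` all of whose monomials have degree at most `-b` in each variable and
total degree at most `-d`. -/
def filtration (N : ℕ) (R : Type) [CommRing R] (b d : ℤ) : AddSubgroup (MvLaurentAtInfty N R) where
  carrier := {g | ∀ n, g.coeff n ≠ 0 → (∀ i, b ≤ n i) ∧ d ≤ ∑ i, n i}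
  zero_mem' := fun n hn => absurd rfl hn
  add_mem' := by
    intro f g hf hg n hn
    by_cases h : f.coeff n = 0
    · exact hg n fun h' => hn (by rw [HahnSeries.coeff_add, h, h', add_zero])
    · exact hf n h
  neg_mem' := fun hf n hn => hf n fun h => hn (by rw [HahnSeries.coeff_neg, h, neg_zero])

theorem filtration_mono {b b' d d' : ℤ} (hb : b' ≤ b) (hd : d' ≤ d) :
    filtration N R b d ≤ filtration N R b' d' := fun _ hg n hn =>
  ⟨fun i => hb.trans ((hg n hn).1 i), hd.trans (hg n hn).2⟩

theorem mul_mem_filtration {b b' d d' : ℤ} {f g : MvLaurentAtInfty N R}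
    (hf : f ∈ filtration N R b d) (hg : g ∈ filtration N R b' d') :
    f * g ∈ filtration N R (b + b') (d + d') := by
  intro n hn
  obtain ⟨k, hk, l, hl, rfl⟩ := Set.mem_add.mp (HahnSeries.support_mul_subset hn)
  obtain ⟨h1, h2⟩ := hf k hk
  obtain ⟨h3, h4⟩ := hg l hl
  refine ⟨fun i => add_le_add (h1 i) (h3 i), ?_⟩
  simp only [Pi.add_apply, Finset.sum_add_distrib]
  exact add_le_add h2 h4

theorem C_mem_filtration (r : R) : HahnSeries.C r ∈ filtration N R 0 0 := by
  intro n hn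
  rw [HahnSeries.C_apply] at hn
  have : n = 0 := by
    by_contra h
    exact hn (HahnSeries.coeff_single_of_ne h)
  subst this
  simp

theorem one_mem_filtration : (1 : MvLaurentAtInfty N R) ∈ filtration N R 0 0 := by
  simpa using C_mem_filtration (N := N) (1 : R)

theorem prod_mem_filtration {ι : Type*} (s : Finset ι) (a : ι → MvLaurentAtInfty N R) (b : ℤ)
    (d : ι → ℤ) (h : ∀ i ∈ s, a i ∈ filtration N R b (d i)) :
    ∏ i ∈ s, a i ∈ filtration N R (s.card * b) (∑ i ∈ s, d i) := by
  classical
  induction s using Finset.induction_on with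
  | empty => simpa using one_mem_filtration
  | insert i s hi ih =>
    rw [Finset.prod_insert hi, Finset.sum_insert hi, Finset.card_insert_of_notMem hi]
    have := mul_mem_filtration (h i (Finset.mem_insert_self i s))
      (ih fun k hk => h k (Finset.mem_insert_of_mem hk))
    refine filtration_mono (le_of_eq ?_) le_rfl this
    push_cast; ring

/-- A telescoping estimate: if corresponding factors are close, then so are the products. -/
theorem prod_sub_prod_mem_filtration {ι : Type*} (s : Finset ι) (a a' : ι → MvLaurentAtInfty N R)
    (b D : ℤ) (d : ι → ℤ) (h : ∀ i ∈ s, a i ∈ filtration N R b (d i))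
    (h' : ∀ i ∈ s, a' i ∈ filtration N R b (d i))
    (hs : ∀ i ∈ s, a i - a' i ∈ filtration N R b (d i + D)) :
    ∏ i ∈ s, a i - ∏ i ∈ s, a' i ∈ filtration N R (s.card * b) (∑ i ∈ s, d i + D) := by
  classical
  induction s using Finset.induction_on with
  | empty => simp
  | insert i s hi ih =>
    rw [Finset.prod_insert hi, Finset.prod_insert hi, Finset.sum_insert hi,
      Finset.card_insert_of_notMem hi]
    have h1 := mul_mem_filtration (hs i (Finset.mem_insert_self i s))
      (prod_mem_filtration s a b d fun k hk => h k (Finset.mem_insert_of_mem hk))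
    have h2 := mul_mem_filtration (h' i (Finset.mem_insert_self i s))
      (ih (fun k hk => h k (Finset.mem_insert_of_mem hk))
        (fun k hk => h' k (Finset.mem_insert_of_mem hk))
        (fun k hk => hs k (Finset.mem_insert_of_mem hk)))
    have h3 : a i * ∏ i ∈ s, a i - a' i * ∏ i ∈ s, a' i =
        (a i - a' i) * ∏ i ∈ s, a i + a' i * (∏ i ∈ s, a i - ∏ i ∈ s, a' i) := by ring
    rw [h3]
    refine add_mem (filtration_mono (le_of_eq ?_) (le_of_eq ?_) h1)
      (filtration_mono (le_of_eq ?_) (le_of_eq ?_) h2) <;> push_cast <;> ring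

theorem det_mem_filtration {ι : Type*} [Fintype ι] [DecidableEq ι]
    (A : Matrix ι ι (MvLaurentAtInfty N R)) (b : ℤ) (d : ι → ℤ)
    (h : ∀ i j, A i j ∈ filtration N R b (d i)) :
    A.det ∈ filtration N R (Fintype.card ι * b) (∑ i, d i) := by
  rw [← Matrix.det_transpose, Matrix.det_apply]
  refine sum_mem fun σ _ => ?_
  rw [Units.smul_def]
  exact zsmul_mem (prod_mem_filtration _ _ b d fun i _ => h i (σ i)) _

theorem det_sub_det_mem_filtration {ι : Type*} [Fintype ι] [DecidableEq ι]
    (A A' : Matrix ι ι (MvLaurentAtInfty N R)) (b D : ℤ) (d : ι → ℤ)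
    (h : ∀ i j, A i j ∈ filtration N R b (d i)) (h' : ∀ i j, A' i j ∈ filtration N R b (d i))
    (hs : ∀ i j, A i j - A' i j ∈ filtration N R b (d i + D)) :
    A.det - A'.det ∈ filtration N R (Fintype.card ι * b) (∑ i, d i + D) := by
  rw [← Matrix.det_transpose, ← Matrix.det_transpose A', Matrix.det_apply, Matrix.det_apply,
    ← Finset.sum_sub_distrib]
  refine sum_mem fun σ _ => ?_
  rw [Units.smul_def, Units.smul_def, ← smul_sub]
  exact zsmul_mem (prod_sub_prod_mem_filtration _ _ _ b D d (fun i _ => h i (σ i))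
    (fun i _ => h' i (σ i)) (fun i _ => hs i (σ i))) _

theorem coeff_mul_yVar_of_commRing (g : MvLaurentAtInfty N R) (j : Fin N) (n : Fin N → ℤ) :
    (g * yVar R j).coeff n = g.coeff (n + Pi.single j 1) := by
  rw [yVar, HahnSeries.coeff_mul_single, mul_one]
  congr 1
  ext i
  by_cases h : i = j
  · subst h; simp
  · simp [h]

/-- If `q (y_a - y_c)` vanishes along a half-line starting next to `m`, then `q` vanishes at `m`:
otherwise `q` would be constant and nonzero on the half-line from `m`, on which the exponent of
`y_c` is unbounded. -/
theorem coeff_eq_zero_of_mul_yVar_sub {a c : Fin N} (hac : a ≠ c) (q : MvLaurentAtInfty N R)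
    (m : Fin N → ℤ) (h : ∀ k : ℕ, (q * (yVar R a - yVar R c)).coeff
      (m + (k : ℤ) • (Pi.single a 1 - Pi.single c 1 : Fin N → ℤ) - Pi.single c 1) = 0) :
    q.coeff m = 0 := by
  by_contra hm
  have h2 : ∀ k : ℕ, m + (k : ℤ) • (Pi.single a 1 - Pi.single c 1 : Fin N → ℤ) ∈ q.support := by
    intro k
    induction k with
    | zero => simpa using hm
    | succ k ih =>
      have h1 := h k
      rw [mul_sub, HahnSeries.coeff_sub, coeff_mul_yVar_of_commRing, coeff_mul_yVar_of_commRing,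
        sub_add_cancel, sub_eq_zero] at h1
      rw [HahnSeries.mem_support, ← h1] at ih
      rw [HahnSeries.mem_support]
      convert ih using 2
      push_cast
      rw [add_smul, one_smul]
      abel
  obtain ⟨β, hβ⟩ := (isPWO_iff_bddBelow _).mp q.isPWO_support
  have h3 := hβ (h2 (m c - β c + 1).toNat) c
  have h4 : m c - β c + 1 ≤ ((m c - β c + 1).toNat : ℤ) := Int.self_le_toNat _
  simp only [Pi.add_apply, Pi.smul_apply, Pi.sub_apply, Pi.single_eq_same,
    Pi.single_eq_of_ne (Ne.symm hac), smul_eq_mul] at h3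
  linarith

theorem mem_filtration_of_mul_yVar_sub {a c : Fin N} (hac : a ≠ c) {q : MvLaurentAtInfty N R}
    {b d : ℤ} (h : q * (yVar R a - yVar R c) ∈ filtration N R b d) : q ∈ filtration N R b d := by
  -- The exponent of `y_a` varies along the half-line, so it is bounded with `a` and `c` exchanged.
  have hneg : q * (yVar R c - yVar R a) ∈ filtration N R b d := by
    rw [← neg_sub, mul_neg]
    exact neg_mem h
  intro m hm
  have key : ∀ a c : Fin N, a ≠ c → q * (yVar R a - yVar R c) ∈ filtration N R b d →
      (∀ i, i ≠ a → b ≤ m i) ∧ d ≤ ∑ i, m i := by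
    intro a c hac h
    by_contra hcon
    apply hm
    refine coeff_eq_zero_of_mul_yVar_sub hac q m fun k => ?_
    by_contra h0
    obtain ⟨h1, h2⟩ := h _ h0
    apply hcon
    refine ⟨fun i hi => ?_, ?_⟩
    · have h3 := h1 i
      have h4 : 0 ≤ (Pi.single c 1 : Fin N → ℤ) i := by
        by_cases hic : i = c
        · subst hic; simp
        · simp [hic]
      have h5 : 0 ≤ (k : ℤ) * (Pi.single c 1 : Fin N → ℤ) i := by positivity
      simp only [Pi.add_apply, Pi.smul_apply, Pi.sub_apply, smul_eq_mul,
        Pi.single_eq_of_ne hi] at h3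
      linarith
    · simp only [Pi.add_apply, Pi.smul_apply, Pi.sub_apply, smul_eq_mul, Finset.sum_add_distrib,
        Finset.sum_sub_distrib, ← Finset.mul_sum, Finset.sum_pi_single'] at h2
      simp at h2
      linarith
  obtain ⟨h1, h2⟩ := key a c hac h
  obtain ⟨h3, -⟩ := key c a hac.symm hneg
  refine ⟨fun i => ?_, h2⟩
  by_cases hi : i = a
  · exact h3 i (by rw [hi]; exact hac)
  · exact h1 i hi

/-- Division by the Vandermonde product does not increase degrees. -/
theorem mem_filtration_of_mul_prod {q : MvLaurentAtInfty N R} {b d : ℤ}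
    (h : q * ∏ a : Fin N, ∏ c ∈ Finset.Ioi a, (yVar R a - yVar R c) ∈ filtration N R b d) :
    q ∈ filtration N R b d := by
  have key : ∀ (ι : Type) (s : Finset ι) (z : ι → MvLaurentAtInfty N R),
      (∀ i ∈ s, ∀ q, q * z i ∈ filtration N R b d → q ∈ filtration N R b d) →
      ∀ q, q * ∏ i ∈ s, z i ∈ filtration N R b d → q ∈ filtration N R b d := by
    classical
    intro ι s z
    induction s using Finset.induction_on with
    | empty => intro _ q hq; simpa using hq
    | insert i s hi ih =>
      intro hz q hq
      rw [Finset.prod_insert hi, ← mul_assoc] at hq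
      exact hz i (Finset.mem_insert_self i s) q
        (ih (fun k hk => hz k (Finset.mem_insert_of_mem hk)) _ hq)
  refine key _ _ _ (fun a _ q hq => key _ _ _ (fun c hc q hq => ?_) q hq) q h
  exact mem_filtration_of_mul_yVar_sub (Finset.mem_Ioi.mp hc).ne hq

theorem mem_filtration_of_mul_C [IsDomain R] {q : MvLaurentAtInfty N R} {b d : ℤ} {r : R}
    (hr : r ≠ 0) (h : q * HahnSeries.C r ∈ filtration N R b d) : q ∈ filtration N R b d := by
  intro n hn
  apply h n
  rw [HahnSeries.C_apply, HahnSeries.coeff_mul_single_zero]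
  exact mul_ne_zero hn hr

end Filtration

/-- A criterion for formal sums. The finite sets `S K` exhaust the index set, and terms outside
`S K` as well as the remainder of the partial sum over `S K` have small total degree. -/
theorem hasFormalSum_of_filtration {α : Type} {N : ℕ} {R : Type} [CommRing R]
    (f : α → MvLaurentAtInfty N R) (F : MvLaurentAtInfty N R) (S : ℕ → Finset α) (b c d : ℤ)
    (h0 : ∀ a, f a ∈ filtration N R b d)
    (h1 : ∀ K : ℕ, ∀ a ∉ S K, f a ∈ filtration N R b (K - c))
    (h2 : ∀ K : ℕ, F - ∑ a ∈ S K, f a ∈ filtration N R b (K - c)) : HasFormalSum f F := by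
  have hbig : ∀ n : Fin N → ℤ, ∃ K : ℕ, ¬ ((K : ℤ) - c ≤ ∑ i, n i) := by
    intro n
    refine ⟨(∑ i, n i + c + 1).toNat, ?_⟩
    have := Int.self_le_toNat (∑ i, n i + c + 1)
    omega
  have hS : ∀ (n : Fin N → ℤ) (K : ℕ), ¬ ((K : ℤ) - c ≤ ∑ i, n i) →
      {a | (f a).coeff n ≠ 0} ⊆ S K := by
    intro n K hK a ha
    by_contra h
    exact hK (h1 K a h n ha).2
  let T : HahnSeries.SummableFamily (Fin N → ℤ) R α :=
    { toFun := f
      isPWO_iUnion_support' := by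
        rw [isPWO_iff_bddBelow]
        refine ⟨fun _ => b, fun n hn i => ?_⟩
        obtain ⟨a, ha⟩ := Set.mem_iUnion.mp hn
        exact (h0 a n ha).1 i
      finite_co_support' := by
        intro n
        obtain ⟨K, hK⟩ := hbig n
        exact (S K).finite_toSet.subset (hS n K hK) }
  refine ⟨T, fun a => rfl, ?_⟩
  ext n
  obtain ⟨K, hK⟩ := hbig n
  rw [HahnSeries.SummableFamily.coeff_hsum,
    finsum_eq_sum_of_support_subset (fun a => (T a).coeff n) (hS n K hK)]
  have h3 : (F - ∑ a ∈ S K, f a).coeff n = 0 := by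
    by_contra h
    exact hK (h2 K n h).2
  rw [HahnSeries.coeff_sub, HahnSeries.coeff_sum, sub_eq_zero] at h3
  exact h3.symm

/-! ### Series in one of the variables and change of coefficients -/

section OneVariable

variable {N : ℕ} {R : Type} [CommRing R]

/-- Substitution `f ↦ f(y_j)` from `R((x⁻¹))` to `R((y₁⁻¹, …, y_N⁻¹))`. -/
noncomputable def substVar (j : Fin N) : HahnSeries ℤ R →+* MvLaurentAtInfty N R :=
  HahnSeries.embDomainRingHom (AddMonoidHom.single (fun _ : Fin N => ℤ) j)
    (by intro a b h; simpa using congrFun h j) (fun a b => Pi.single_le_single)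

theorem coeff_substVar_single (j : Fin N) (f : HahnSeries ℤ R) (k : ℤ) :
    (substVar j f).coeff (Pi.single j k) = f.coeff k :=
  HahnSeries.embDomain_coeff (a := k)

theorem coeff_substVar_of_forall_ne (j : Fin N) (f : HahnSeries ℤ R) (n : Fin N → ℤ)
    (hn : ∀ k : ℤ, n ≠ Pi.single j k) : (substVar j f).coeff n = 0 := by
  refine HahnSeries.embDomain_of_notMem_range ?_
  rintro ⟨k, hk⟩
  exact hn k hk.symm

theorem substVar_mem_filtration (j : Fin N) (f : HahnSeries ℤ R) {b d : ℤ} (hb : b ≤ 0)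
    (hbd : b ≤ d) (h : ∀ k < d, f.coeff k = 0) : substVar j f ∈ filtration N R b d := by
  intro n hn
  by_cases hk : ∃ k : ℤ, n = Pi.single j k
  · obtain ⟨k, rfl⟩ := hk
    rw [coeff_substVar_single] at hn
    have hdk : d ≤ k := by
      by_contra hlt
      exact hn (h k (not_le.mp hlt))
    refine ⟨fun i => ?_, ?_⟩
    · by_cases hi : i = j
      · subst hi; simpa using hbd.trans hdk
      · simpa [hi] using hb
    · simpa using hdk
  · exact absurd (coeff_substVar_of_forall_ne j f n (not_exists.mp hk)) hn

/-- The expansion of `(x + r)⁻¹` in `R((x⁻¹))`. -/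
noncomputable def recip (r : R) : HahnSeries ℤ R :=
  HahnSeries.ofSuppBddBelow (fun n : ℤ => if 0 < n then (-r) ^ (n - 1).toNat else 0) (by
    refine ⟨0, fun n hn => ?_⟩
    rw [Function.mem_support] at hn
    by_contra hlt
    exact hn (if_neg (by omega)))

theorem coeff_recip (r : R) (n : ℤ) :
    (recip r).coeff n = if 0 < n then (-r) ^ (n - 1).toNat else 0 := rfl

theorem coeff_recip_add_one (r : R) (m : ℕ) : (recip r).coeff (m + 1) = (-r) ^ m := by
  rw [coeff_recip, if_pos (by omega)]
  simp

theorem mul_recip (r : R) :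
    (HahnSeries.single (-1 : ℤ) (1 : R) + HahnSeries.C r) * recip r = 1 := by
  ext n
  rw [add_mul, HahnSeries.coeff_add, HahnSeries.coeff_single_mul, one_mul,
    HahnSeries.C_mul_eq_smul, HahnSeries.coeff_smul, smul_eq_mul, coeff_recip, coeff_recip,
    HahnSeries.coeff_one]
  rcases lt_trichotomy n 0 with h | rfl | h
  · rw [if_neg (by omega), if_neg (by omega), if_neg (by omega)]; simp
  · simp
  · rw [if_pos (by omega), if_pos (by omega), if_neg (by omega)]
    obtain ⟨m, rfl⟩ : ∃ m : ℕ, n = m + 1 := ⟨(n - 1).toNat, by omega⟩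
    have h1 : ((m : ℤ) + 1 - -1 - 1).toNat = m + 1 := by omega
    have h2 : ((m : ℤ) + 1 - 1).toNat = m := by omega
    rw [h1, h2]
    ring

theorem yVar_add_C_mul (j : Fin N) (r : R) :
    (yVar R j + HahnSeries.C r) * substVar j (recip r) = 1 := by
  have h1 : substVar j (HahnSeries.single (-1 : ℤ) (1 : R)) = yVar R j :=
    HahnSeries.embDomain_single
  have h2 : (HahnSeries.C r : MvLaurentAtInfty N R) = substVar j (HahnSeries.C r) :=
    HahnSeries.embDomainRingHom_C.symm
  rw [← h1, h2, ← map_add, ← map_mul, mul_recip, map_one]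

end OneVariable

section Coefficients

variable {M N : ℕ}

/-- Change of coefficients is multiplicative. -/
theorem map_mul_hahnSeries {Γ R S : Type} [AddCommGroup Γ] [PartialOrder Γ] [IsOrderedAddMonoid Γ]
    [CommRing R] [CommRing S] (φ : R →+* S) (f g : HahnSeries Γ R) :
    (f * g).map φ = f.map φ * g.map φ := by
  classical
  ext n
  have hs : ∀ h : HahnSeries Γ R, (h.map φ).support ⊆ h.support := by
    intro h k hk hk'
    exact hk (by simp [hk'])
  rw [HahnSeries.map_coeff, HahnSeries.coeff_mul, HahnSeries.coeff_mul_left' f.isPWO_support (hs f)]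
  rw [map_sum]
  symm
  refine Finset.sum_subset_zero_on_sdiff ?_ ?_ ?_
  · intro p hp
    rw [Finset.mem_antidiagonal] at hp ⊢
    exact ⟨hp.1, hs g hp.2.1, hp.2.2⟩
  · intro p hp
    rw [Finset.mem_sdiff, Finset.mem_antidiagonal, Finset.mem_antidiagonal] at hp
    have : (g.map φ).coeff p.2 = 0 := by
      by_contra h
      exact hp.2 ⟨hp.1.1, h, hp.1.2.2⟩
    rw [map_mul, ← HahnSeries.map_coeff g φ, this, mul_zero]
  · intro p _
    simp

/-- The inclusion `ℂ((y⁻¹)) → ℂ[x]((y⁻¹))` as a ring homomorphism. -/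
noncomputable def liftCoeffsHom (M N : ℕ) :
    MvLaurentAtInfty N ℂ →+* MvLaurentAtInfty N (MvPolynomial (Fin M) ℂ) where
  toFun := liftCoeffs M
  map_one' := by
    rw [liftCoeffs, ← HahnSeries.C_one, HahnSeries.map_C, map_one, HahnSeries.C_one]
  map_mul' := map_mul_hahnSeries _
  map_zero' := by ext; simp [liftCoeffs]
  map_add' f g := by ext; simp [liftCoeffs]

theorem liftCoeffsHom_apply (f : MvLaurentAtInfty N ℂ) : liftCoeffsHom M N f = liftCoeffs M f := rfl

theorem liftCoeffs_yVar (j : Fin N) : liftCoeffs M (yVar ℂ j) = yVar _ j := by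
  ext1
  funext n
  change MvPolynomial.C ((HahnSeries.single _ (1 : ℂ)).coeff n) = _
  rw [yVar, HahnSeries.coeff_single, HahnSeries.coeff_single]
  split_ifs <;> simp

theorem liftCoeffs_evalAt (j : Fin N) (f : LaurentAtInfty) :
    liftCoeffs M (evalAt j f) =
      substVar j (HahnSeries.map f (MvPolynomial.C : ℂ →+* MvPolynomial (Fin M) ℂ)) := by
  ext1
  funext n
  change MvPolynomial.C ((substVar j f).coeff n) = _
  by_cases hk : ∃ k : ℤ, n = Pi.single j k
  · obtain ⟨k, rfl⟩ := hk
    rw [coeff_substVar_single, coeff_substVar_single]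
    rfl
  · rw [coeff_substVar_of_forall_ne _ _ _ (not_exists.mp hk),
      coeff_substVar_of_forall_ne _ _ _ (not_exists.mp hk), map_zero]

end Coefficients

namespace IsCauchyPair

variable {f : ℕ → ℂ[X]} {F : ℤ → LaurentAtInfty} {M N : ℕ}

theorem coeff_eq_zero_of_lt_neg (h : IsCauchyPair f F) (n k : ℤ) (hk : k < -n) :
    (F n).coeff k = 0 := by
  rcases le_or_gt 0 n with hn | hn
  · obtain ⟨m, rfl⟩ := Int.eq_ofNat_of_zero_le hn
    obtain ⟨g, hg, hg'⟩ := h.exists_poly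
    obtain ⟨l, rfl⟩ : ∃ l : ℕ, k = -(l : ℤ) := ⟨(-k).toNat, by omega⟩
    rw [hg, DeltaOperator.coeff_ofPoly]
    apply coeff_eq_zero_of_natDegree_lt
    rw [(hg' m).2]
    omega
  · obtain ⟨m, rfl⟩ : ∃ m : ℕ, n = -1 - m := ⟨(-1 - n).toNat, by omega⟩
    exact h.coeff_eq_zero m k (by omega)

theorem liftCoeffs_evalAt_mem (h : IsCauchyPair f F) (j : Fin N) {b n : ℤ} (hb : b ≤ 0)
    (hbn : b ≤ -n) :
    liftCoeffs M (evalAt j (F n)) ∈ filtration N (MvPolynomial (Fin M) ℂ) b (-n) := by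
  rw [liftCoeffs_evalAt]
  refine substVar_mem_filtration j _ hb hbn fun k hk => ?_
  rw [HahnSeries.map_coeff, h.coeff_eq_zero_of_lt_neg n k hk, map_zero]

/-- The expansion `1 / (y + x) = ∑ (-1) ^ n f_n(x) F_{-1-n}(y)`, with its remainder. -/
theorem recip_sub_sum_mem (h : IsCauchyPair f F) (i : Fin M) (j : Fin N) (K : ℕ) :
    substVar j (recip (MvPolynomial.X i)) - ∑ n ∈ Finset.range K,
      HahnSeries.C ((-1) ^ n * aeval (MvPolynomial.X i) (f n)) *
        liftCoeffs M (evalAt j (F (-1 - n))) ∈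
      filtration N (MvPolynomial (Fin M) ℂ) 0 K := by
  have hC : ∀ r : MvPolynomial (Fin M) ℂ, (HahnSeries.C r : MvLaurentAtInfty N _) =
      substVar j (HahnSeries.C r) := fun r => HahnSeries.embDomainRingHom_C.symm
  simp only [liftCoeffs_evalAt, hC, ← map_mul, ← map_sum, ← map_sub]
  refine substVar_mem_filtration j _ le_rfl (by positivity) fun k hk => ?_
  rw [HahnSeries.coeff_sub, HahnSeries.coeff_sum]
  rcases le_or_gt k 0 with hk0 | hk0
  · rw [coeff_recip, if_neg (by omega), Finset.sum_eq_zero, sub_zero]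
    intro n _
    rw [HahnSeries.C_mul_eq_smul, HahnSeries.coeff_smul, HahnSeries.map_coeff,
      h.coeff_eq_zero n k (by omega), map_zero, smul_zero]
  · obtain ⟨m, rfl⟩ : ∃ m : ℕ, k = m + 1 := ⟨(k - 1).toNat, by omega⟩
    have h1 := congrArg (aeval (MvPolynomial.X i : MvPolynomial (Fin M) ℂ))
      (h.sum_eq m K (by omega))
    rw [coeff_recip_add_one, sub_eq_zero]
    simp only [map_sum, map_smul, map_pow, map_neg, aeval_X] at h1
    rw [← h1]
    refine Finset.sum_congr rfl fun n _ => ?_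
    rw [HahnSeries.C_mul_eq_smul, HahnSeries.coeff_smul, HahnSeries.map_coeff,
      MvPolynomial.smul_eq_C_mul, smul_eq_mul, map_mul, map_pow]
    simp only [map_neg, map_one]
    ring

end IsCauchyPair

/-! ### The Cauchy–Binet expansion of an alternating map -/

/-- The strictly decreasing sequences of length `m` with entries below `K`. -/
noncomputable def strictAntiSeqs (m K : ℕ) : Finset (Fin m → ℕ) :=
  open Classical in (Fintype.piFinset fun _ => Finset.range K).filter StrictAnti

theorem mem_strictAntiSeqs {m K : ℕ} {s : Fin m → ℕ} :
    s ∈ strictAntiSeqs m K ↔ (∀ k, s k < K) ∧ StrictAnti s := by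
  simp [strictAntiSeqs]

/-- The Cauchy–Binet formula: an alternating map of `m` linear combinations of vectors `b_0, …,
b_{K-1}` is the sum over `s_1 > ⋯ > s_m` of the `m × m` minors of the coefficients times the values
at `b_{s_1}, …, b_{s_m}`. -/
theorem alternatingMap_sum_smul {A V : Type*} [CommRing A] [AddCommGroup V] [Module A V] {m : ℕ}
    (g : V [⋀^Fin m]→ₗ[A] A) (X : Fin m → ℕ → A) (b : ℕ → V) (K : ℕ) :
    g (fun k => ∑ n ∈ Finset.range K, X k n • b n) =
      ∑ s ∈ strictAntiSeqs m K,
        Matrix.det (Matrix.of fun k l => X k (s l)) * g fun l => b (s l) := by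
  classical
  have h1 : g (fun k => ∑ n ∈ Finset.range K, X k n • b n) =
      ∑ φ ∈ Fintype.piFinset fun _ : Fin m => Finset.range K,
        (∏ k, X k (φ k)) * g fun k => b (φ k) := by
    rw [← AlternatingMap.coe_multilinearMap, MultilinearMap.map_sum_finset]
    refine Finset.sum_congr rfl fun φ _ => ?_
    rw [MultilinearMap.map_smul_univ, smul_eq_mul]
  have h2 : ∑ φ ∈ Fintype.piFinset fun _ : Fin m => Finset.range K,
        (∏ k, X k (φ k)) * g (fun k => b (φ k)) =
      ∑ φ ∈ (Fintype.piFinset fun _ : Fin m => Finset.range K).filter Function.Injective,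
        (∏ k, X k (φ k)) * g fun k => b (φ k) := by
    symm
    refine Finset.sum_filter_of_ne fun φ _ hne => ?_
    by_contra hφ
    apply hne
    rw [Function.not_injective_iff] at hφ
    obtain ⟨k, l, hkl, hne⟩ := hφ
    rw [g.map_eq_zero_of_eq (fun k => b (φ k)) (by simp only [hkl]) hne, mul_zero]
  have h3 : ∑ s ∈ strictAntiSeqs m K,
        Matrix.det (Matrix.of fun k l => X k (s l)) * g (fun l => b (s l)) =
      ∑ p ∈ strictAntiSeqs m K ×ˢ (Finset.univ : Finset (Equiv.Perm (Fin m))),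
        (∏ k, X k (p.1 (p.2 k))) * g fun k => b (p.1 (p.2 k)) := by
    rw [Finset.sum_product]
    refine Finset.sum_congr rfl fun s _ => ?_
    rw [← Matrix.det_transpose, Matrix.det_apply', Finset.sum_mul]
    refine Finset.sum_congr rfl fun σ _ => ?_
    have := g.map_perm (fun l => b (s l)) σ
    simp only [Function.comp_def] at this
    rw [this, Units.smul_def, zsmul_eq_mul]
    simp only [Matrix.transpose_apply, Matrix.of_apply]
    ring
  rw [h1, h2, h3]
  symm
  refine Finset.sum_nbij (fun p => p.1 ∘ p.2) ?_ ?_ ?_ fun _ _ => rfl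
  · rintro ⟨s, σ⟩ hp
    rw [Finset.mem_product, mem_strictAntiSeqs] at hp
    rw [Finset.mem_filter, Fintype.mem_piFinset]
    exact ⟨fun k => Finset.mem_range.mpr (hp.1.1 _), hp.1.2.injective.comp σ.injective⟩
  · rintro ⟨s, σ⟩ hp ⟨s', σ'⟩ hp' heq
    rw [Finset.mem_coe, Finset.mem_product, mem_strictAntiSeqs] at hp hp'
    simp only at heq hp hp'
    have hr : Set.range s = Set.range s' := by
      rw [← σ.surjective.range_comp s, heq, σ'.surjective.range_comp]
    have hs : s = s' := by
      have hm := hp.1.2.comp (Fin.rev_strictAnti (n := m))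
      have hm' := hp'.1.2.comp (Fin.rev_strictAnti (n := m))
      have hr' : Set.range (s ∘ Fin.rev) = Set.range (s' ∘ Fin.rev) := by
        rw [Fin.rev_surjective.range_comp, Fin.rev_surjective.range_comp, hr]
      have := (hm.range_inj hm').mp hr'
      funext k
      have := congrFun this (Fin.rev k)
      simpa using this
    subst hs
    have : σ = σ' := by
      ext k : 1
      exact hp.1.2.injective (congrFun heq k)
    rw [this]
  · intro φ hφ
    rw [Finset.mem_coe, Finset.mem_filter, Fintype.mem_piFinset] at hφ
    have hmono : StrictMono (φ ∘ Tuple.sort φ) :=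
      (Tuple.monotone_sort φ).strictMono_of_injective (hφ.2.comp (Equiv.injective _))
    refine ⟨(φ ∘ Tuple.sort φ ∘ Fin.revPerm, (Fin.revPerm.trans (Tuple.sort φ)).symm), ?_, ?_⟩
    · rw [Finset.mem_coe, Finset.mem_product, mem_strictAntiSeqs]
      refine ⟨⟨fun k => Finset.mem_range.mp (hφ.1 _), ?_⟩, Finset.mem_univ _⟩
      exact hmono.comp_strictAnti Fin.rev_strictAnti
    · funext k
      change φ ((Fin.revPerm.trans (Tuple.sort φ))
        ((Fin.revPerm.trans (Tuple.sort φ)).symm k)) = φ k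
      rw [Equiv.apply_symm_apply]

section Determinants

theorem fromRows_update {A ι κ : Type*} [DecidableEq ι] [DecidableEq κ]
    (P : Matrix ι (ι ⊕ κ) A) (w : κ → ι ⊕ κ → A) (k : κ) (z : ι ⊕ κ → A) :
    Matrix.fromRows P (Matrix.of (Function.update w k z)) =
      (Matrix.fromRows P (Matrix.of w)).updateRow (Sum.inr k) z := by
  ext i j
  rcases i with i | i
  · simp
  · by_cases hik : i = k
    · subst hik; simp
    · simp [Matrix.updateRow_apply, hik]

variable {A : Type*} [CommRing A] {ι κ : Type*} [Fintype ι] [Fintype κ] [DecidableEq ι]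
  [decκ : DecidableEq κ]

/-- The determinant of a matrix with prescribed upper rows as an alternating map of its lower
rows. -/
def detLowerRows (P : Matrix ι (ι ⊕ κ) A) : (ι ⊕ κ → A) [⋀^κ]→ₗ[A] A where
  toFun w := Matrix.det (Matrix.fromRows P (Matrix.of w))
  map_update_add' := by
    intro dec w k x y
    obtain rfl : dec = decκ := Subsingleton.elim _ _
    rw [fromRows_update, fromRows_update, fromRows_update, Matrix.det_updateRow_add]
  map_update_smul' := by
    intro dec w k c x
    obtain rfl : dec = decκ := Subsingleton.elim _ _
    rw [fromRows_update, fromRows_update, Matrix.det_updateRow_smul, smul_eq_mul]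
  map_eq_zero_of_eq' := by
    intro w k l h hkl
    refine Matrix.det_zero_of_row_eq (i := Sum.inr k) (j := Sum.inr l) (by simpa using hkl) ?_
    exact h

theorem detLowerRows_apply (P : Matrix ι (ι ⊕ κ) A) (w : κ → ι ⊕ κ → A) :
    detLowerRows P w = Matrix.det (Matrix.fromRows P (Matrix.of w)) := rfl

theorem det_fromRows_mul_right (P : Matrix ι (ι ⊕ κ) A) (L : Matrix κ κ A)
    (T : Matrix κ (ι ⊕ κ) A) :
    Matrix.det (Matrix.fromRows P (L * T)) = L.det * Matrix.det (Matrix.fromRows P T) := by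
  have : Matrix.fromRows P (L * T) = Matrix.fromBlocks 1 0 0 L * Matrix.fromRows P T := by
    rw [Matrix.fromBlocks_mul_fromRows]
    simp
  rw [this, Matrix.det_mul, Matrix.det_fromBlocks_zero₁₂, Matrix.det_one, one_mul]

theorem det_fromRows_add_mul (P : Matrix ι (ι ⊕ κ) A) (Y : Matrix κ ι A)
    (T : Matrix κ (ι ⊕ κ) A) :
    Matrix.det (Matrix.fromRows P (Y * P + T)) = Matrix.det (Matrix.fromRows P T) := by
  have : Matrix.fromRows P (Y * P + T) = Matrix.fromBlocks 1 0 Y 1 * Matrix.fromRows P T := by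
    rw [Matrix.fromBlocks_mul_fromRows]
    simp
  rw [this, Matrix.det_mul, Matrix.det_fromBlocks_zero₁₂, Matrix.det_one, Matrix.det_one, one_mul,
    one_mul]

end Determinants

/-! ### Row permutations -/

theorem sign_revPerm (m : ℕ) :
    Equiv.Perm.sign (Fin.revPerm : Equiv.Perm (Fin m)) = ∏ l : Fin m, (-1) ^ (Fin.rev l : ℕ) := by
  rw [Equiv.Perm.sign_eq_prod_prod_Ioi]
  refine Finset.prod_congr rfl fun i _ => ?_
  rw [Finset.prod_congr rfl (g := fun _ => -1), Finset.prod_const, Fin.card_Ioi]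
  · congr 1
    rw [Fin.val_rev]
    omega
  · intro j hj
    rw [if_neg]
    simpa using (Finset.mem_Ioi.mp hj).le

theorem det_mul_rev {A : Type*} [CommRing A] {m : ℕ} (W : Matrix (Fin m) (Fin m) A)
    (ε : Fin m → A) :
    Matrix.det (Matrix.of fun k i : Fin m => ε i * W (Fin.rev i) k) =
      (∏ i, ε i) * ((∏ l : Fin m, (-1) ^ (Fin.rev l : ℕ)) * W.det) := by
  have h := Matrix.det_permute (Fin.revPerm (n := m)) W
  have h2 : (((∏ l : Fin m, (-1) ^ (Fin.rev l : ℕ) : ℤˣ) : ℤ) : A) =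
      ∏ l : Fin m, (-1) ^ (Fin.rev l : ℕ) := by
    push_cast; rfl
  rw [sign_revPerm, h2] at h
  rw [← h, ← Matrix.det_mul_column, ← Matrix.det_transpose]
  rfl

/-- The reversal of the last `m` rows. -/
theorem det_fromRows_rev {A : Type*} [CommRing A] {r m : ℕ}
    (W : Matrix (Fin (r + m)) (Fin (r + m)) A) :
    Matrix.det (Matrix.fromRows
      (Matrix.of fun (i : Fin r) j => W (Fin.castAdd m i) (finSumFinEquiv j))
      (Matrix.of fun (l : Fin m) j => W (Fin.natAdd r (Fin.rev l)) (finSumFinEquiv j))) =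
    (∏ l : Fin m, (-1) ^ (Fin.rev l : ℕ)) * W.det := by
  have h := Matrix.det_permute (Equiv.sumCongr (Equiv.refl (Fin r)) (Fin.revPerm (n := m)))
    (W.submatrix finSumFinEquiv finSumFinEquiv)
  have h1 := Equiv.Perm.sign_sumCongr (1 : Equiv.Perm (Fin r)) (Fin.revPerm (n := m))
  rw [Equiv.Perm.sign_one, one_mul, sign_revPerm] at h1
  rw [show Equiv.sumCongr (Equiv.refl (Fin r)) (Fin.revPerm (n := m)) =
    Equiv.Perm.sumCongr 1 Fin.revPerm from rfl, h1, Matrix.det_submatrix_equiv_self] at h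
  have h2 : (((∏ l : Fin m, (-1) ^ (Fin.rev l : ℕ) : ℤˣ) : ℤ) : A) =
      ∏ l : Fin m, (-1) ^ (Fin.rev l : ℕ) := by
    push_cast; rfl
  rw [h2] at h
  rw [← h]
  congr 1
  ext i j
  rcases i with i | l
  · simp
  · simp

/-- The exchange of the block of the first `m` rows with the block of the last `r` rows. -/
theorem det_fromRows_swap {A : Type*} [CommRing A] {r m : ℕ}
    (W : Matrix (Fin (r + m)) (Fin (r + m)) A) :
    Matrix.det (Matrix.fromRows
      (Matrix.of fun (i : Fin r) j =>
        W (Fin.cast (add_comm m r) (Fin.natAdd m i)) (finSumFinEquiv j))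
      (Matrix.of fun (l : Fin m) j =>
        W (Fin.cast (add_comm m r) (Fin.castAdd r l)) (finSumFinEquiv j))) =
    (-1) ^ (r * m) * W.det := by
  set σ : Equiv.Perm (Fin (r + m)) := finAddFlip.trans (finCongr (add_comm m r)) with hσ
  have hl : ∀ i : Fin r, σ (Fin.castAdd m i) = Fin.cast (add_comm m r) (Fin.natAdd m i) := by
    intro i; simp [hσ]
  have hr : ∀ l : Fin m, σ (Fin.natAdd r l) = Fin.cast (add_comm m r) (Fin.castAdd r l) := by
    intro l; simp [hσ]
  have hs : Equiv.Perm.sign σ = (-1) ^ (r * m) := by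
    have h0 : ∀ i, ∏ j ∈ Finset.Ioi i, (if σ i < σ j then (1 : ℤˣ) else -1) =
        ∏ j, if i < j then (if σ i < σ j then (1 : ℤˣ) else -1) else 1 := by
      intro i
      rw [← Finset.prod_filter]
      refine Finset.prod_congr ?_ fun _ _ => rfl
      ext j; simp
    rw [Equiv.Perm.sign_eq_prod_prod_Ioi, Finset.prod_congr rfl fun i _ => h0 i]
    simp_rw [Fin.prod_univ_add, hl, hr, Fin.lt_def, Fin.val_cast, Fin.val_natAdd, Fin.val_castAdd]
    have e1 : ∀ i j : Fin r, (if (i : ℕ) < j then (if m + (i : ℕ) < m + j then (1 : ℤˣ) else -1)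
        else 1) = 1 := by
      intro i j; split_ifs <;> first | rfl | omega
    have e2 : ∀ (i : Fin r) (l : Fin m), (if (i : ℕ) < r + l then
        (if m + (i : ℕ) < l then (1 : ℤˣ) else -1) else 1) = -1 := by
      intro i l; split_ifs <;> first | rfl | omega
    have e3 : ∀ (l : Fin m) (i : Fin r), (if r + (l : ℕ) < i then
        (if (l : ℕ) < m + i then (1 : ℤˣ) else -1) else 1) = 1 := by
      intro i l; split_ifs <;> first | rfl | omega
    have e4 : ∀ k l : Fin m, (if r + (k : ℕ) < r + l then (if (k : ℕ) < l then (1 : ℤˣ) else -1)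
        else 1) = 1 := by
      intro i j; split_ifs <;> first | rfl | omega
    simp_rw [e1, e2, e3, e4]
    simp [pow_mul']
  have h := Matrix.det_permute σ W
  rw [hs] at h
  have h2 : ((((-1) ^ (r * m) : ℤˣ) : ℤ) : A) = (-1) ^ (r * m) := by push_cast; rfl
  rw [h2] at h
  rw [← h, ← Matrix.det_submatrix_equiv_self finSumFinEquiv]
  congr 1
  ext i j
  rcases i with i | l
  · simp [hl]
  · simp [hr]

/-! ### A Cauchy determinant bordered by polynomials -/

/-- The Newton interpolation formula for `a ↦ 1 / (u + a)` at `a = v_k`. -/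
theorem newton_inverse {A : Type*} [CommRing A] (u : A) (v c : ℕ → A) (m k : ℕ) (hk : k < m)
    (hc : ∀ l < m, (u + v l) * c l = 1) :
    c k = ∑ l ∈ Finset.range m, (∏ i ∈ Finset.range l, (v i - v k)) *
      ∏ i ∈ Finset.range (l + 1), c i := by
  have key : ∀ p ≤ m, c k = ∑ l ∈ Finset.range p, (∏ i ∈ Finset.range l, (v i - v k)) *
      ∏ i ∈ Finset.range (l + 1), c i +
      (∏ i ∈ Finset.range p, (v i - v k)) * (∏ i ∈ Finset.range p, c i) * c k := by
    intro p
    induction p with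
    | zero => simp
    | succ p ih =>
      intro hp
      rw [Finset.sum_range_succ, Finset.prod_range_succ (fun i => v i - v k),
        Finset.prod_range_succ c]
      have h1 := hc p (by omega)
      have h2 := hc k hk
      have h3 : c k = c p + (v p - v k) * c p * c k := by
        linear_combination (-c k) * h1 + c p * h2
      linear_combination ih (by omega) +
        (∏ i ∈ Finset.range p, (v i - v k)) * (∏ i ∈ Finset.range p, c i) * h3
  have h := key m le_rfl
  rw [Finset.prod_eq_zero (i := k) (f := fun i => v i - v k) (Finset.mem_range.mpr hk) (sub_self _)]
    at h
  simpa using h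

theorem prod_range_val {A : Type*} [CommMonoid A] {m : ℕ} (g : ℕ → A) (l : Fin m) :
    ∏ i ∈ Finset.range l, g i = ∏ i ∈ Finset.Iio l, g i := by
  rw [← Nat.Iio_eq_range, ← Fin.map_valEmbedding_Iio, Finset.prod_map]
  rfl

/-- With `u = (u_a)` of length `r + m` and `v = (v_k)` of length `m`, the determinant with rows
`h_{r-1}(u), …, h_0(u)` and `1 / (u + v_1), …, 1 / (u + v_m)`, where `h_n` is any monic polynomial
of degree `n`. Newton interpolation in `v` replaces the last rows with the inverses of `(u + v_1) ⋯
(u + v_l)`, at the cost of the Vandermonde product in `v`. -/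
theorem det_cauchy {A : Type} [CommRing A] {r m : ℕ} (u : Fin (r + m) → A) (v : Fin m → A)
    (c : Fin m → Fin (r + m) → A) (hc : ∀ k j, (u j + v k) * c k j = 1) (h : ℕ → A[X])
    (hh : ∀ n, (h n).Monic ∧ (h n).natDegree = n) :
    Matrix.det (Matrix.fromRows
      (Matrix.of fun (i : Fin r) j => (h (Fin.rev i : ℕ)).eval (u (finSumFinEquiv j)))
      (Matrix.of fun (k : Fin m) j => c k (finSumFinEquiv j))) =
    (∏ k, ∏ j, c k j) * ((∏ a, ∏ b ∈ Finset.Ioi a, (u a - u b)) *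
      ∏ a, ∏ b ∈ Finset.Ioi a, (v a - v b)) := by
  nontriviality A
  set e : Fin r ⊕ Fin m ≃ Fin (r + m) := finSumFinEquiv with he
  -- `L` collects the coefficients of Newton interpolation at `v_1, …, v_m`.
  let v' : ℕ → A := fun n => if h : n < m then v ⟨n, h⟩ else 0
  have hv' : ∀ k : Fin m, v' k = v k := fun k => by simp [v']
  let L : Matrix (Fin m) (Fin m) A := Matrix.of fun k l => ∏ i ∈ Finset.Iio l, (v i - v k)
  let T : Matrix (Fin m) (Fin r ⊕ Fin m) A := Matrix.of fun l j => ∏ i ∈ Finset.Iic l, c i (e j)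
  have hLT : (Matrix.of fun (k : Fin m) j => c k (e j)) = L * T := by
    ext k j
    let c' : ℕ → A := fun n => if h : n < m then c ⟨n, h⟩ (e j) else 0
    have hc' : ∀ k : Fin m, c' k = c k (e j) := fun k => by simp [c']
    have h1 := newton_inverse (u (e j)) v' c' m k k.2 (fun l hl => by
      have := hc ⟨l, hl⟩ (e j)
      simpa [v', c', hl] using this)
    rw [hc', Finset.sum_range] at h1
    rw [Matrix.of_apply, h1, Matrix.mul_apply]
    refine Finset.sum_congr rfl fun l _ => ?_
    congr 1
    · rw [prod_range_val (fun i => v' i - v' k)]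
      simp only [hv']
      rfl
    · rw [Finset.prod_range_succ, prod_range_val c']
      simp only [hc']
      change _ = ∏ i ∈ Finset.Iic l, c i (e j)
      rw [← Finset.prod_Iio_mul_eq_prod_Iic]
  have hL : L.det = ∏ a, ∏ b ∈ Finset.Ioi a, (v a - v b) := by
    rw [Matrix.det_of_isLowerTriangular L]
    · change ∏ k, ∏ i ∈ Finset.Iio k, (v i - v k) = _
      exact Finset.prod_comm' (by simp)
    · intro k l hkl
      exact Finset.prod_eq_zero (i := k) (Finset.mem_Iio.mpr hkl) (sub_self _)
  -- Clearing the denominators of the columns leaves a matrix of monic polynomials in `u`.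
  let H : ℕ → A[X] := fun n => (if n < m then 1 else h (n - m)) *
    ∏ k ∈ Finset.univ.filter (fun k : Fin m => (k : ℕ) < n), (X + C (v (Fin.rev k)))
  have hH : ∀ n, (H n).Monic ∧ (H n).natDegree = n := by
    intro n
    have h1 : (∏ k ∈ Finset.univ.filter (fun k : Fin m => (k : ℕ) < n),
        (X + C (v (Fin.rev k)))).Monic := monic_prod_of_monic _ _ fun k _ => monic_X_add_C _
    have h2 : (∏ k ∈ Finset.univ.filter (fun k : Fin m => (k : ℕ) < n),
        (X + C (v (Fin.rev k)))).natDegree = min m n := by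
      rw [natDegree_prod_of_monic _ _ fun k _ => monic_X_add_C _]
      simp [Fin.card_filter_val_lt]
    by_cases hn : n < m
    · simp only [H, if_pos hn, one_mul]
      exact ⟨h1, by omega⟩
    · simp only [H, if_neg hn]
      refine ⟨(hh _).1.mul h1, ?_⟩
      rw [(hh _).1.natDegree_mul h1, (hh _).2, h2]
      omega
  have hmon := det_monic u H hH
  let D : Fin (r + m) → A := fun j => ∏ k, (u j + v k)
  have hrev : ∀ (j : Fin (r + m)) (p : Fin m → Prop) [DecidablePred p],
      ∏ k ∈ Finset.univ.filter (fun k => p (Fin.rev k)), (u j + v (Fin.rev k)) =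
        ∏ k ∈ Finset.univ.filter p, (u j + v k) := by
    intro j p _
    rw [Finset.prod_filter, Finset.prod_filter, ← Equiv.prod_comp Fin.revPerm]
    simp
  have hHe : ∀ n j, (H n).eval (u j) = (if n < m then 1 else (h (n - m)).eval (u j)) *
      ∏ k ∈ Finset.univ.filter (fun k : Fin m => (Fin.rev k : ℕ) < n), (u j + v k) := by
    intro n j
    rw [← hrev]
    simp only [H, eval_mul, eval_prod, eval_add, eval_X, eval_C, Fin.rev_rev]
    split_ifs <;> simp
  have hPT : Matrix.of (fun i j => D (e j) * Matrix.fromRows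
      (Matrix.of fun (i : Fin r) j => (h (Fin.rev i : ℕ)).eval (u (e j))) T i j) =
      (Matrix.of fun i j : Fin (r + m) => (H (Fin.rev i : ℕ)).eval (u j)).submatrix e e := by
    ext i j
    rw [Matrix.submatrix_apply, Matrix.of_apply, Matrix.of_apply, hHe]
    rcases i with i | l
    · have h1 : (Fin.rev (e (Sum.inl i)) : ℕ) = m + Fin.rev i := by
        simp only [he, finSumFinEquiv_apply_left, Fin.val_rev, Fin.val_castAdd]
        omega
      rw [h1, if_neg (by omega), Nat.add_sub_cancel_left, Matrix.fromRows_apply_inl,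
        Matrix.of_apply, mul_comm, Finset.filter_true_of_mem]
      intro k _
      have := (Fin.rev k).2
      omega
    · have h1 : (Fin.rev (e (Sum.inr l)) : ℕ) = Fin.rev l := by
        simp only [he, finSumFinEquiv_apply_right, Fin.val_rev, Fin.val_natAdd]
        omega
      have h2 : Finset.univ.filter (fun k : Fin m => (Fin.rev k : ℕ) < Fin.rev l) =
          Finset.univ.filter (fun k => ¬ k ≤ l) := by
        ext k
        simp only [Finset.mem_filter, Finset.mem_univ, true_and, Fin.val_rev, Fin.le_def]
        omega
      have h3 : Finset.univ.filter (fun k : Fin m => k ≤ l) = Finset.Iic l := by ext; simp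
      rw [h1, if_pos (Fin.rev l).2, one_mul, Matrix.fromRows_apply_inr, h2]
      simp only [D, T, Matrix.of_apply]
      rw [← Finset.prod_filter_mul_prod_filter_not Finset.univ (fun k => k ≤ l), h3,
        mul_right_comm, ← Finset.prod_mul_distrib, Finset.prod_congr rfl fun k _ => hc k (e j),
        Finset.prod_const_one, one_mul]
  have hdet := Matrix.det_mul_row (fun j => D (e j)) (Matrix.fromRows
      (Matrix.of fun (i : Fin r) j => (h (Fin.rev i : ℕ)).eval (u (e j))) T)
  rw [hPT, Matrix.det_submatrix_equiv_self, hmon, Equiv.prod_comp e D] at hdet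
  have hcD : (∏ k, ∏ j, c k j) * ∏ j, D j = 1 := by
    simp only [D]
    rw [Finset.prod_comm, ← Finset.prod_mul_distrib]
    refine Finset.prod_eq_one fun j _ => ?_
    rw [← Finset.prod_mul_distrib]
    refine Finset.prod_eq_one fun k _ => ?_
    rw [mul_comm, hc]
  rw [hLT, det_fromRows_mul_right, hL, hdet]
  linear_combination (-(∏ a, ∏ b ∈ Finset.Ioi a, (v a - v b)) * (Matrix.fromRows
      (Matrix.of fun (i : Fin r) j => (h (Fin.rev i : ℕ)).eval (u (e j))) T).det) * hcD

/-! ### Young diagrams and strictly decreasing sequences -/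

section Diagrams

variable {d : ℕ}

theorem rowLen_eq_zero_of_colLen_le {l : YoungDiagram} (hl : l.colLen 0 ≤ d) {i : ℕ} (hi : d ≤ i) :
    l.rowLen i = 0 := by
  by_contra h
  have h1 : (i, 0) ∈ l := YoungDiagram.mem_iff_lt_rowLen.mpr (Nat.pos_of_ne_zero h)
  have := YoungDiagram.mem_iff_lt_colLen.mp h1
  omega

theorem card_eq_sum_rowLen {l : YoungDiagram} (hl : l.colLen 0 ≤ d) :
    l.card = ∑ i : Fin d, l.rowLen i := by
  rw [← Finset.sum_range, YoungDiagram.card,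
    Finset.card_eq_sum_card_fiberwise (f := Prod.fst) (t := Finset.range d)]
  · refine Finset.sum_congr rfl fun i _ => ?_
    rw [YoungDiagram.rowLen_eq_card, YoungDiagram.row]
  · rintro ⟨i, j⟩ hij
    rw [Finset.mem_coe, YoungDiagram.mem_cells] at hij
    have h1 := YoungDiagram.mem_iff_lt_colLen.mp hij
    have h2 := l.colLen_anti 0 j (Nat.zero_le j)
    simp only [Finset.coe_range, Set.mem_Iio]
    omega

/-- The sequence `λ_l + d - l` of a diagram `λ` with at most `d` rows, `l = 1, …, d`. -/
def diagramSeq (l : DiagramOfDepthLE d) : Fin d → ℕ := fun i => l.1.rowLen i + Fin.rev i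

theorem diagramSeq_strictAnti (l : DiagramOfDepthLE d) : StrictAnti (diagramSeq l) := by
  intro i j hij
  have h1 := l.1.rowLen_anti i j (Fin.le_def.mp hij.le)
  have h2 := Fin.lt_def.mp hij
  simp only [diagramSeq, Fin.val_rev]
  omega

theorem diagramSeq_injective : Function.Injective (diagramSeq (d := d)) := by
  intro l l' h
  have h1 : ∀ i, l.1.rowLen i = l'.1.rowLen i := by
    intro i
    by_cases hi : i < d
    · have := congrFun h ⟨i, hi⟩
      simpa [diagramSeq] using this
    · rw [rowLen_eq_zero_of_colLen_le l.2 (not_lt.mp hi),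
        rowLen_eq_zero_of_colLen_le l'.2 (not_lt.mp hi)]
  apply Subtype.ext
  apply YoungDiagram.ext
  ext ⟨i, j⟩
  rw [YoungDiagram.mem_cells, YoungDiagram.mem_cells, YoungDiagram.mem_iff_lt_rowLen,
    YoungDiagram.mem_iff_lt_rowLen, h1]

/-- A strictly decreasing sequence of natural numbers drops by at least `p` in `p` steps. -/
theorem add_le_of_strictAnti {s : Fin d → ℕ} (hs : StrictAnti s) (p : ℕ) :
    ∀ k l : Fin d, (l : ℕ) = k + p → s l + p ≤ s k := by
  induction p with
  | zero =>
    intro k l h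
    rw [Fin.ext h, add_zero]
  | succ p ih =>
    intro k l h
    have h1 := ih k ⟨k + p, by omega⟩ rfl
    have h2 : s l < s ⟨k + p, by omega⟩ := hs (Fin.lt_def.mpr (by simp only; omega))
    omega

theorem exists_diagramSeq_eq {s : Fin d → ℕ} (hs : StrictAnti s) : ∃ l, diagramSeq l = s := by
  have h1 : ∀ k, (Fin.rev k : ℕ) ≤ s k := by
    intro k
    have hk := k.2
    have := add_le_of_strictAnti hs (Fin.rev k) k ⟨d - 1, by omega⟩ (by
      simp only [Fin.val_rev]; omega)
    omega
  have h2 : Antitone fun k => s k - (Fin.rev k : ℕ) := by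
    intro k l hkl
    have hkl' := Fin.le_def.mp hkl
    have h3 := add_le_of_strictAnti hs (l - k) k l (by omega)
    have hl := l.2
    simp only [Fin.val_rev]
    omega
  let w : List ℕ := List.ofFn fun k => s k - (Fin.rev k : ℕ)
  have hw : w.SortedGE := List.sortedGE_ofFn_iff.mpr h2
  have hlen : w.length = d := List.length_ofFn
  refine ⟨⟨YoungDiagram.ofRowLens w hw, ?_⟩, ?_⟩
  · by_contra hlt
    have h3 := YoungDiagram.mem_iff_lt_colLen.mpr (not_le.mp hlt)
    obtain ⟨h4, -⟩ := YoungDiagram.mem_ofRowLens.mp h3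
    simp only at h4
    omega
  · funext k
    have h3 : (YoungDiagram.ofRowLens w hw).rowLen k = s k - (Fin.rev k : ℕ) := by
      have := YoungDiagram.rowLen_ofRowLens (hw := hw) ⟨k, by rw [hlen]; exact k.2⟩
      simpa [w] using this
    change (YoungDiagram.ofRowLens w hw).rowLen k + (Fin.rev k : ℕ) = s k
    rw [h3, Nat.sub_add_cancel (h1 k)]

/-- The diagrams `λ` with at most `d` rows and `λ_1 + d - 1 < K`. -/
noncomputable def boundedDiagrams (d K : ℕ) : Finset (DiagramOfDepthLE d) :=
  (strictAntiSeqs d K).preimage diagramSeq diagramSeq_injective.injOn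

theorem sum_boundedDiagrams {A : Type*} [AddCommMonoid A] (K : ℕ) (g : (Fin d → ℕ) → A) :
    ∑ l ∈ boundedDiagrams d K, g (diagramSeq l) = ∑ s ∈ strictAntiSeqs d K, g s := by
  refine Finset.sum_preimage _ _ _ _ fun s hs hs' => ?_
  exact absurd (exists_diagramSeq_eq (mem_strictAntiSeqs.mp hs).2) hs'

theorem le_card_add_of_notMem {K : ℕ} {l : DiagramOfDepthLE d} (hl : l ∉ boundedDiagrams d K) :
    K ≤ l.1.card + d := by
  rw [boundedDiagrams, Finset.mem_preimage, mem_strictAntiSeqs, not_and_or] at hl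
  rcases hl with hl | hl
  · rw [not_forall] at hl
    obtain ⟨k, hk⟩ := hl
    have h1 : l.1.rowLen k ≤ ∑ i : Fin d, l.1.rowLen i :=
      Finset.single_le_sum (f := fun i : Fin d => l.1.rowLen i) (fun _ _ => Nat.zero_le _)
        (Finset.mem_univ k)
    rw [← card_eq_sum_rowLen l.2] at h1
    have h2 := (Fin.rev k).2
    rw [diagramSeq] at hk
    omega
  · exact absurd (diagramSeq_strictAnti l) hl

end Diagrams

/-! ### The partial sums of the Cauchy identity -/

section PartialSums

variable {f : ℕ → ℂ[X]} {F : ℤ → LaurentAtInfty} {M N : ℕ}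

theorem C_alternantPoly (f : ℕ → ℂ[X]) (l : Fin M → ℕ) :
    (HahnSeries.C (alternantPoly f l) : MvLaurentAtInfty N (MvPolynomial (Fin M) ℂ)) =
      Matrix.det (Matrix.of fun i j : Fin M =>
        HahnSeries.C (aeval (MvPolynomial.X j) (f (l i + (Fin.rev i : ℕ))))) := by
  rw [alternantPoly, RingHom.map_det]
  rfl

theorem liftCoeffs_alternant (F : ℤ → LaurentAtInfty) (l : Fin N → ℤ) :
    liftCoeffs M (alternant F l) = Matrix.det (Matrix.of fun i j : Fin N =>
        liftCoeffs M (evalAt j (F (l i + ((Fin.rev i : ℕ) : ℤ))))) := by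
  rw [alternant, ← liftCoeffsHom_apply, RingHom.map_det]
  rfl

theorem liftCoeffs_evalAt_ofPoly (j : Fin N) (g : ℂ[X]) :
    liftCoeffs M (evalAt j (DeltaOperator.ofPoly g)) =
      (g.map ((liftCoeffsHom M N).comp HahnSeries.C)).eval (yVar _ j) := by
  rw [evalAt_ofPoly, ← liftCoeffsHom_apply, eval_map, hom_eval₂, eval_map, liftCoeffsHom_apply,
    liftCoeffs_yVar]

theorem C_aeval_X (i : Fin M) (g : ℂ[X]) :
    (HahnSeries.C (aeval (MvPolynomial.X i) g) : MvLaurentAtInfty N (MvPolynomial (Fin M) ℂ)) =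
      (g.map (HahnSeries.C.comp (algebraMap ℂ (MvPolynomial (Fin M) ℂ)))).eval
        (HahnSeries.C (MvPolynomial.X i)) := by
  rw [aeval_def, hom_eval₂, eval_map]

theorem C_alternantPoly_zero (hf : ∀ n, (f n).Monic ∧ (f n).natDegree = n) :
    (HahnSeries.C (alternantPoly (N := M) f 0) : MvLaurentAtInfty N (MvPolynomial (Fin M) ℂ)) =
      ∏ a, ∏ b ∈ Finset.Ioi a,
        (HahnSeries.C (MvPolynomial.X a) - HahnSeries.C (MvPolynomial.X b)) := by
  rw [alternantPoly_zero f hf]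
  simp only [map_prod, map_sub]

theorem IsCauchyPair.liftCoeffs_alternant_zero (h : IsCauchyPair f F) :
    liftCoeffs M (alternant (N := N) F 0) =
      ∏ a, ∏ b ∈ Finset.Ioi a, (yVar (MvPolynomial (Fin M) ℂ) a - yVar _ b) := by
  obtain ⟨g, hg, hg'⟩ := h.exists_poly
  rw [alternant_zero F g hg hg', ← liftCoeffsHom_apply]
  simp only [map_prod, map_sub, liftCoeffsHom_apply, liftCoeffs_yVar]

theorem recip_mem_filtration (i : Fin M) (j : Fin N) :
    substVar j (recip (MvPolynomial.X i)) ∈ filtration N (MvPolynomial (Fin M) ℂ) 0 0 := by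
  refine substVar_mem_filtration j _ le_rfl le_rfl fun k hk => ?_
  rw [coeff_recip, if_neg (by omega)]

/-- The error caused by replacing the lower rows of a determinant with approximations. -/
theorem det_fromRows_sub_mem {R : Type} [CommRing R] {ι κ : Type*} [Fintype ι] [Fintype κ]
    [DecidableEq ι] [DecidableEq κ] (P : Matrix ι (ι ⊕ κ) (MvLaurentAtInfty N R))
    (T E : Matrix κ (ι ⊕ κ) (MvLaurentAtInfty N R)) (b : ℤ) (hb : b ≤ 0) (K : ℕ)
    (hP : ∀ i j, P i j ∈ filtration N R b b) (hT : ∀ i j, T i j ∈ filtration N R 0 0)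
    (hTE : ∀ i j, T i j - E i j ∈ filtration N R 0 K) :
    Matrix.det (Matrix.fromRows P T) - Matrix.det (Matrix.fromRows P E) ∈
      filtration N R (Fintype.card (ι ⊕ κ) * b) (Fintype.card (ι ⊕ κ) * b + K) := by
  have h := det_sub_det_mem_filtration (Matrix.fromRows P T) (Matrix.fromRows P E) b K
    (fun _ => b) ?_ ?_ ?_
  · simpa [-Fintype.card_sum] using h
  · rintro (i | k) j
    · exact hP i j
    · exact filtration_mono hb hb (hT k j)
  · rintro (i | k) j
    · exact hP i j
    · have h1 := sub_mem (hT k j) (filtration_mono le_rfl (Int.natCast_nonneg K) (hTE k j))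
      rw [sub_sub_cancel] at h1
      exact filtration_mono hb hb h1
  · rintro (i | k) j
    · simp
    · exact filtration_mono hb (by omega) (hTE k j)

/-- The product of the expansions of all `1 / (y_j + x_i)`. -/
noncomputable def recipProd (M N : ℕ) : MvLaurentAtInfty N (MvPolynomial (Fin M) ℂ) :=
  ∏ i : Fin M, ∏ j : Fin N, substVar j (recip (MvPolynomial.X i))

theorem neg_one_pow_mul_self {A : Type*} [CommRing A] (k : ℕ) :
    (-1 : A) ^ k * (-1) ^ k = 1 := by
  rw [← mul_pow]; simp

theorem prod_neg_one_pow_rev {A : Type*} [CommRing A] {m : ℕ} :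
    (∏ l : Fin m, (-1 : A) ^ (Fin.rev l : ℕ)) * ∏ l : Fin m, (-1 : A) ^ (Fin.rev l : ℕ) = 1 := by
  rw [← Finset.prod_mul_distrib]
  exact Finset.prod_eq_one fun l _ => neg_one_pow_mul_self _

theorem prod_neg_one_pow_diagramSeq {A : Type*} [CommRing A] {d : ℕ} (l : DiagramOfDepthLE d) :
    ∏ i, (-1 : A) ^ diagramSeq l i = (-1) ^ l.1.card * ∏ i : Fin d, (-1 : A) ^ (Fin.rev i : ℕ) := by
  simp only [diagramSeq, pow_add, Finset.prod_mul_distrib]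
  rw [Finset.prod_pow_eq_pow_sum, card_eq_sum_rowLen l.2]

theorem prod_neg_one_pow_add_diagramSeq {A : Type*} [CommRing A] {d : ℕ} (r : ℕ)
    (l : DiagramOfDepthLE d) : ∏ i, (-1 : A) ^ (r + diagramSeq l i) =
      (-1) ^ (r * d) * ((-1) ^ l.1.card * ∏ i : Fin d, (-1 : A) ^ (Fin.rev i : ℕ)) := by
  rw [← prod_neg_one_pow_diagramSeq, pow_mul, ← Fin.prod_const, ← Finset.prod_mul_distrib]
  exact Finset.prod_congr rfl fun i _ => pow_add _ _ _

/-- The term of `λ` in the Cauchy–Binet expansion for `M = m ≤ N = r + m`. The second factor is the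
alternant of `λ‡` up to a reversal of the last `m` rows; in the first `r` rows `λ‡` has the entry
`-m`, which makes them the polynomial ones. The signs of the reversal and of the `m` expansions
cancel up to `(-1) ^ |λ|`. -/
theorem det_mul_det_of_le {r m : ℕ} (l : DiagramOfDepthLE m) :
    Matrix.det (Matrix.of fun k i : Fin m => (HahnSeries.C ((-1) ^ diagramSeq l i *
        aeval (MvPolynomial.X k) (f (diagramSeq l i))) :
          MvLaurentAtInfty (r + m) (MvPolynomial (Fin m) ℂ))) *
      Matrix.det (Matrix.fromRows
        (Matrix.of fun (i : Fin r) j =>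
          liftCoeffs m (evalAt (finSumFinEquiv j) (F ((Fin.rev i : ℕ) : ℤ))))
        (Matrix.of fun (i : Fin m) j =>
          liftCoeffs m (evalAt (finSumFinEquiv j) (F (-1 - (diagramSeq l i : ℕ)))))) =
    (-1) ^ l.1.card * HahnSeries.C (alternantPoly f fun i : Fin m => l.1.rowLen i) *
      liftCoeffs m (alternant F (ddagger m l.1 : Fin (r + m) → ℤ)) := by
  have h1 : Matrix.det (Matrix.of fun k i : Fin m => (HahnSeries.C ((-1) ^ diagramSeq l i *
        aeval (MvPolynomial.X k) (f (diagramSeq l i))) :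
          MvLaurentAtInfty (r + m) (MvPolynomial (Fin m) ℂ))) =
      (∏ i, (-1) ^ diagramSeq l i) *
        HahnSeries.C (alternantPoly f fun i : Fin m => l.1.rowLen i) := by
    rw [C_alternantPoly, ← Matrix.det_mul_column, ← Matrix.det_transpose]
    congr 1
    refine Matrix.ext fun i k => ?_
    simp only [Matrix.transpose_apply, Matrix.of_apply, map_mul, map_pow, map_neg, map_one]
    rfl
  have h2 := det_fromRows_rev (Matrix.of fun i j : Fin (r + m) => liftCoeffs m
    (evalAt j (F ((ddagger m l.1 : Fin (r + m) → ℤ) i + ((Fin.rev i : ℕ) : ℤ)))))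
  have e1 : ∀ i : Fin r, (ddagger m l.1 : Fin (r + m) → ℤ) (Fin.castAdd m i) +
      ((Fin.rev (Fin.castAdd m i) : ℕ) : ℤ) = ((Fin.rev i : ℕ) : ℤ) := by
    intro i
    have hr : (Fin.rev (Fin.castAdd m i) : ℕ) = m + Fin.rev i := by
      simp only [Fin.val_rev, Fin.val_castAdd]; omega
    rw [ddagger, hr, rowLen_eq_zero_of_colLen_le l.2 (by omega)]
    push_cast
    ring
  have e2 : ∀ i : Fin m, (ddagger m l.1 : Fin (r + m) → ℤ) (Fin.natAdd r (Fin.rev i)) +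
      ((Fin.rev (Fin.natAdd r (Fin.rev i)) : ℕ) : ℤ) = -1 - (diagramSeq l i : ℕ) := by
    intro i
    have hr : (Fin.rev (Fin.natAdd r (Fin.rev i)) : ℕ) = i := by
      simp only [Fin.val_rev, Fin.val_natAdd]; omega
    rw [ddagger, hr, diagramSeq, Fin.val_rev]
    have := i.2
    push_cast [this]
    omega
  simp only [Matrix.of_apply, e1, e2] at h2
  rw [← liftCoeffs_alternant] at h2
  rw [h1, h2, prod_neg_one_pow_diagramSeq]
  linear_combination ((-1) ^ l.1.card *
    HahnSeries.C (alternantPoly f fun i : Fin m => l.1.rowLen i) *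
      liftCoeffs m (alternant F (ddagger m l.1 : Fin (r + m) → ℤ))) *
    prod_neg_one_pow_rev (A := MvLaurentAtInfty (r + m) (MvPolynomial (Fin m) ℂ)) (m := m)

theorem IsCauchyPair.partialSum_of_le (h : IsCauchyPair f F) (r m K : ℕ) :
    recipProd m (r + m) *
        (HahnSeries.C (alternantPoly (N := m) f 0) * liftCoeffs m (alternant (N := r + m) F 0)) -
      ∑ l ∈ boundedDiagrams m K, (-1) ^ l.1.card *
        HahnSeries.C (alternantPoly f fun i : Fin m => l.1.rowLen i) *
        liftCoeffs m (alternant F (ddagger m l.1 : Fin (r + m) → ℤ)) ∈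
      filtration (r + m) (MvPolynomial (Fin m) ℂ) (((r + m : ℕ) : ℤ) * -r)
        (((r + m : ℕ) : ℤ) * -r + K) := by
  obtain ⟨g, hg, hg'⟩ := h.exists_poly
  set P : Matrix (Fin r) (Fin r ⊕ Fin m) (MvLaurentAtInfty (r + m) (MvPolynomial (Fin m) ℂ)) :=
    Matrix.of fun (i : Fin r) j =>
      liftCoeffs m (evalAt (finSumFinEquiv j) (F ((Fin.rev i : ℕ) : ℤ))) with hP
  have h1 := det_cauchy (r := r) (m := m) (fun j => yVar (MvPolynomial (Fin m) ℂ) j)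
    (fun k => HahnSeries.C (MvPolynomial.X k)) (fun k j => substVar j (recip (MvPolynomial.X k)))
    (fun k j => yVar_add_C_mul j _)
    (fun n => (g n).map ((liftCoeffsHom m (r + m)).comp HahnSeries.C))
    (fun n => ⟨(hg' n).1.map _, by rw [(hg' n).1.natDegree_map, (hg' n).2]⟩)
  simp only [← liftCoeffs_evalAt_ofPoly, ← hg] at h1
  rw [← hP, ← C_alternantPoly_zero h.monic, ← h.liftCoeffs_alternant_zero] at h1
  have h2 := alternatingMap_sum_smul (detLowerRows P)
    (fun k n => HahnSeries.C ((-1) ^ n * aeval (MvPolynomial.X k) (f n)))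
    (fun n j => liftCoeffs m (evalAt (finSumFinEquiv j) (F (-1 - n)))) K
  rw [← sum_boundedDiagrams] at h2
  simp only [detLowerRows_apply] at h2
  rw [Finset.sum_congr rfl fun l _ => det_mul_det_of_le l] at h2
  rw [← h2, recipProd, mul_comm (HahnSeries.C _), ← h1]
  have h3 := det_fromRows_sub_mem P
    (Matrix.of fun (k : Fin m) j => substVar (finSumFinEquiv j) (recip (MvPolynomial.X k)))
    (Matrix.of fun k => ∑ n ∈ Finset.range K,
      (HahnSeries.C ((-1) ^ n * aeval (MvPolynomial.X k) (f n)) :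
        MvLaurentAtInfty (r + m) (MvPolynomial (Fin m) ℂ)) •
        fun j => liftCoeffs m (evalAt (finSumFinEquiv j) (F (-1 - n)))) (-r) (by omega) K
    (fun i j => ?_) (fun k j => recip_mem_filtration _ _) (fun k j => ?_)
  · simpa using h3
  · have hi := (Fin.rev i).2
    exact filtration_mono le_rfl (by omega) (h.liftCoeffs_evalAt_mem _ (by omega) (by omega))
  · have := h.recip_sub_sum_mem k (finSumFinEquiv j) K
    simpa [Finset.sum_apply] using this

/-- The term of `λ` in the Cauchy–Binet expansion for `M = r + m ≥ N = m`. The alternant of `λ`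
arises from the second factor by an exchange of two blocks of rows, as the rows `f_{r-1}, …, f_0`
belong to the indices beyond the last row of `λ`; the alternant of `λ‡` arises from the first factor
by a reversal. -/
theorem det_mul_det_of_ge {r m : ℕ} (l : DiagramOfDepthLE m) :
    Matrix.det (Matrix.of fun k i : Fin m => ((-1) ^ (r + diagramSeq l i) *
        liftCoeffs (r + m) (evalAt k (F (-1 - ((r + diagramSeq l i : ℕ) : ℤ)))))) *
      Matrix.det (Matrix.fromRows
        (Matrix.of fun (i : Fin r) j => (HahnSeries.C
          (aeval (MvPolynomial.X (finSumFinEquiv j)) (f (Fin.rev i : ℕ))) :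
            MvLaurentAtInfty m (MvPolynomial (Fin (r + m)) ℂ)))
        (Matrix.of fun (i : Fin m) j => HahnSeries.C
          (aeval (MvPolynomial.X (finSumFinEquiv j)) (f (r + diagramSeq l i))))) =
    (-1) ^ l.1.card * HahnSeries.C (alternantPoly f fun i : Fin (r + m) => l.1.rowLen i) *
      liftCoeffs (r + m) (alternant F (ddagger (r + m) l.1 : Fin m → ℤ)) := by
  have h1 : Matrix.det (Matrix.of fun k i : Fin m => ((-1) ^ (r + diagramSeq l i) *
        liftCoeffs (r + m) (evalAt k (F (-1 - ((r + diagramSeq l i : ℕ) : ℤ)))))) =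
      (∏ i, (-1) ^ (r + diagramSeq l i)) * ((∏ i : Fin m, (-1) ^ (Fin.rev i : ℕ)) *
        liftCoeffs (r + m) (alternant F (ddagger (r + m) l.1 : Fin m → ℤ))) := by
    have h2 := det_mul_rev (Matrix.of fun i j : Fin m =>
      liftCoeffs (r + m) (evalAt j (F ((ddagger (r + m) l.1 : Fin m → ℤ) i +
        ((Fin.rev i : ℕ) : ℤ))))) fun i => (-1) ^ (r + diagramSeq l i)
    have e : ∀ i, (ddagger (r + m) l.1 : Fin m → ℤ) (Fin.rev i) + ((i : ℕ) : ℤ) =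
        -1 - ((r + diagramSeq l i : ℕ) : ℤ) := by
      intro i
      rw [ddagger, Fin.rev_rev, diagramSeq, Fin.val_rev]
      have := i.2
      omega
    rw [← liftCoeffs_alternant] at h2
    simp only [Matrix.of_apply, Fin.rev_rev, e] at h2
    exact h2
  have h2 := det_fromRows_swap (Matrix.of fun i j : Fin (r + m) => (HahnSeries.C
    (aeval (MvPolynomial.X j) (f (l.1.rowLen i + (Fin.rev i : ℕ)))) :
      MvLaurentAtInfty m (MvPolynomial (Fin (r + m)) ℂ)))
  have e1 : ∀ i : Fin r, l.1.rowLen (Fin.cast (add_comm m r) (Fin.natAdd m i) : ℕ) +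
      (Fin.rev (Fin.cast (add_comm m r) (Fin.natAdd m i)) : ℕ) = Fin.rev i := by
    intro i
    rw [rowLen_eq_zero_of_colLen_le l.2 (by simp)]
    simp only [Fin.val_rev, Fin.val_cast, Fin.val_natAdd]
    omega
  have e2 : ∀ i : Fin m, l.1.rowLen (Fin.cast (add_comm m r) (Fin.castAdd r i) : ℕ) +
      (Fin.rev (Fin.cast (add_comm m r) (Fin.castAdd r i)) : ℕ) = r + diagramSeq l i := by
    intro i
    simp only [diagramSeq, Fin.val_rev, Fin.val_cast, Fin.val_castAdd]
    omega
  simp only [Matrix.of_apply, e1, e2] at h2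
  rw [← C_alternantPoly] at h2
  have hsq := neg_one_pow_mul_self
    (A := MvLaurentAtInfty m (MvPolynomial (Fin (r + m)) ℂ)) (r * m)
  have hrev := prod_neg_one_pow_rev
    (A := MvLaurentAtInfty m (MvPolynomial (Fin (r + m)) ℂ)) (m := m)
  rw [h1, h2, prod_neg_one_pow_add_diagramSeq]
  set ε := ∏ i : Fin m, (-1 : MvLaurentAtInfty m (MvPolynomial (Fin (r + m)) ℂ)) ^ (Fin.rev i : ℕ)
  set t := (-1) ^ l.1.card * HahnSeries.C (alternantPoly f fun i : Fin (r + m) => l.1.rowLen i) *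
      liftCoeffs (r + m) (alternant F (ddagger (r + m) l.1 : Fin m → ℤ)) with ht
  linear_combination (t * ε * ε) * hsq + t * hrev

theorem IsCauchyPair.partialSum_of_ge (h : IsCauchyPair f F) (r m K : ℕ) :
    recipProd (r + m) m *
        (HahnSeries.C (alternantPoly (N := r + m) f 0) *
          liftCoeffs (r + m) (alternant (N := m) F 0)) -
      ∑ l ∈ boundedDiagrams m K, (-1) ^ l.1.card *
        HahnSeries.C (alternantPoly f fun i : Fin (r + m) => l.1.rowLen i) *
        liftCoeffs (r + m) (alternant F (ddagger (r + m) l.1 : Fin m → ℤ)) ∈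
      filtration m (MvPolynomial (Fin (r + m)) ℂ) 0 K := by
  set P : Matrix (Fin r) (Fin r ⊕ Fin m) (MvLaurentAtInfty m (MvPolynomial (Fin (r + m)) ℂ)) :=
    Matrix.of fun (i : Fin r) j =>
      HahnSeries.C (aeval (MvPolynomial.X (finSumFinEquiv j)) (f (Fin.rev i : ℕ))) with hP
  have h1 := det_cauchy (r := r) (m := m)
    (fun j => (HahnSeries.C (MvPolynomial.X j) :
      MvLaurentAtInfty m (MvPolynomial (Fin (r + m)) ℂ)))
    (fun k => yVar (MvPolynomial (Fin (r + m)) ℂ) k)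
    (fun k j => substVar k (recip (MvPolynomial.X j)))
    (fun k j => (congrArg (· * _) (add_comm _ _)).trans (yVar_add_C_mul k _))
    (fun n => (f n).map (HahnSeries.C.comp (algebraMap ℂ (MvPolynomial (Fin (r + m)) ℂ))))
    (fun n => ⟨(h.monic n).1.map _, by rw [(h.monic n).1.natDegree_map, (h.monic n).2]⟩)
  simp only [← C_aeval_X] at h1
  rw [← hP, ← C_alternantPoly_zero h.monic, ← h.liftCoeffs_alternant_zero, Finset.prod_comm] at h1
  -- The terms with `n < r` of the expansions are linear combinations of the polynomial rows.
  let Y : Matrix (Fin m) (Fin r) (MvLaurentAtInfty m (MvPolynomial (Fin (r + m)) ℂ)) :=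
    Matrix.of fun k i => (-1) ^ (Fin.rev i : ℕ) *
      liftCoeffs (r + m) (evalAt k (F (-1 - ((Fin.rev i : ℕ) : ℤ))))
  let T : Matrix (Fin m) (Fin r ⊕ Fin m) (MvLaurentAtInfty m (MvPolynomial (Fin (r + m)) ℂ)) :=
    Matrix.of fun k => ∑ n ∈ Finset.range K, ((-1) ^ (r + n) *
      liftCoeffs (r + m) (evalAt k (F (-1 - ((r + n : ℕ) : ℤ))))) •
      fun j => HahnSeries.C (aeval (MvPolynomial.X (finSumFinEquiv j)) (f (r + n)))
  have h2 := alternatingMap_sum_smul (detLowerRows P)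
    (fun k n => (-1) ^ (r + n) *
      liftCoeffs (r + m) (evalAt k (F (-1 - ((r + n : ℕ) : ℤ)))))
    (fun n j => HahnSeries.C (aeval (MvPolynomial.X (finSumFinEquiv j)) (f (r + n)))) K
  rw [← sum_boundedDiagrams] at h2
  simp only [detLowerRows_apply] at h2
  rw [Finset.sum_congr rfl fun l _ => det_mul_det_of_ge l] at h2
  rw [← h2, recipProd, ← h1]
  change _ - Matrix.det (Matrix.fromRows P T) ∈ _
  rw [← det_fromRows_add_mul P Y T]
  have h3 := det_fromRows_sub_mem P
    (Matrix.of fun (k : Fin m) j => substVar k (recip (MvPolynomial.X (finSumFinEquiv j))))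
    (Y * P + T) 0 le_rfl K
    (fun i j => C_mem_filtration _) (fun k j => recip_mem_filtration _ _) (fun k j => ?_)
  · simpa using h3
  · have h4 := filtration_mono le_rfl (by omega : (K : ℤ) ≤ ((r + K : ℕ) : ℤ))
      (h.recip_sub_sum_mem (finSumFinEquiv j) k (r + K))
    convert h4 using 1
    rw [Matrix.of_apply, Matrix.add_apply, Finset.sum_range_add]
    congr 2
    · rw [Matrix.mul_apply, Finset.sum_range, ← Equiv.sum_comp Fin.revPerm]
      refine Finset.sum_congr rfl fun i _ => ?_
      simp only [Y, hP, Matrix.of_apply, Fin.revPerm_apply, Fin.rev_rev, map_mul, map_pow,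
        map_neg, map_one]
      ring
    · simp only [T, Matrix.of_apply, Finset.sum_apply, Pi.smul_apply, smul_eq_mul, map_mul, map_pow,
        map_neg, map_one]
      refine Finset.sum_congr rfl fun n _ => ?_
      ring

end PartialSums

/-! ### The Cauchy identity -/

theorem isUnit_yVar_add {M N : ℕ} (i : Fin M) (j : Fin N) :
    IsUnit (yVar (MvPolynomial (Fin M) ℂ) j + HahnSeries.C (MvPolynomial.X i)) :=
  IsUnit.of_mul_eq_one _ (yVar_add_C_mul j _)

theorem inverse_yVar_add {M N : ℕ} (i : Fin M) (j : Fin N) :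
    Ring.inverse (yVar (MvPolynomial (Fin M) ℂ) j + HahnSeries.C (MvPolynomial.X i)) =
      substVar j (recip (MvPolynomial.X i)) := by
  rw [← one_mul (substVar j _), ← Ring.inverse_mul_cancel _ (isUnit_yVar_add i j), mul_assoc,
    yVar_add_C_mul, mul_one]

namespace IsCauchyPair

variable {f : ℕ → ℂ[X]} {F : ℤ → LaurentAtInfty} {M N : ℕ}

theorem mem_filtration_of_mul (h : IsCauchyPair f F) {b d : ℤ}
    {q : MvLaurentAtInfty N (MvPolynomial (Fin M) ℂ)}
    (hq : q * (HahnSeries.C (alternantPoly (N := M) f 0) *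
      liftCoeffs M (alternant (N := N) F 0)) ∈ filtration N _ b d) : q ∈ filtration N _ b d := by
  rw [← mul_assoc, h.liftCoeffs_alternant_zero] at hq
  exact mem_filtration_of_mul_C
    (nonZeroDivisors.ne_zero (alternantPoly_zero_mem f h.monic)) (mem_filtration_of_mul_prod hq)

/-- The alternant of `λ‡` has total degree at most `N ^ 2 - |λ|`: its row with index `n` has degree
at most `n`, and the indices of the rows add up to at most `N ^ 2 - |λ|`. -/
theorem liftCoeffs_alternant_ddagger_mem (h : IsCauchyPair f F) (l : YoungDiagram)
    (hl : l.colLen 0 ≤ N) : liftCoeffs M (alternant F (ddagger M l : Fin N → ℤ)) ∈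
      filtration N (MvPolynomial (Fin M) ℂ) (-(N * N : ℕ)) (l.card - (N * N : ℕ)) := by
  rw [liftCoeffs_alternant]
  have h1 := det_mem_filtration (Matrix.of fun i j : Fin N =>
    liftCoeffs M (evalAt j (F ((ddagger M l : Fin N → ℤ) i + ((Fin.rev i : ℕ) : ℤ))))) (-(N : ℤ))
    (fun i => -((ddagger M l : Fin N → ℤ) i + ((Fin.rev i : ℕ) : ℤ))) (fun i j => by
      have := (Fin.rev i).2
      exact h.liftCoeffs_evalAt_mem j (by omega) (by rw [ddagger]; omega))
  refine filtration_mono (le_of_eq ?_) ?_ h1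
  · rw [Fintype.card_fin]; push_cast; ring
  · have h2 : ∑ i : Fin N, ((l.rowLen i : ℤ) - N) ≤
        ∑ i : Fin N, -((ddagger M l : Fin N → ℤ) i + ((Fin.rev i : ℕ) : ℤ)) := by
      rw [← Equiv.sum_comp Fin.revPerm]
      refine Finset.sum_le_sum fun i _ => ?_
      have := (Fin.rev i).2
      rw [ddagger, Fin.revPerm_apply]
      omega
    refine le_trans (le_of_eq ?_) h2
    rw [card_eq_sum_rowLen hl, Finset.sum_sub_distrib]
    simp

/-- The partial sums of the Cauchy identity, multiplied by the two
denominators, approximate the product of all `1 / (y_j + x_i)`. -/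
theorem exists_partialSum_mem (h : IsCauchyPair f F) (M N : ℕ) : ∃ c : ℕ, ∀ K : ℕ,
    recipProd M N *
        (HahnSeries.C (alternantPoly (N := M) f 0) * liftCoeffs M (alternant (N := N) F 0)) -
      ∑ l ∈ boundedDiagrams (min M N) K, (-1) ^ l.1.card *
        HahnSeries.C (alternantPoly f fun i : Fin M => l.1.rowLen i) *
        liftCoeffs M (alternant F (ddagger M l.1 : Fin N → ℤ)) ∈
      filtration N (MvPolynomial (Fin M) ℂ) (-c) (K - c) := by
  generalize hd : min M N = d
  rcases le_total M N with hMN | hMN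
  · obtain ⟨r, rfl⟩ := Nat.exists_eq_add_of_le' hMN
    obtain rfl : M = d := by omega
    refine ⟨(r + M) * r, fun K => ?_⟩
    refine filtration_mono (le_of_eq ?_) (le_of_eq ?_) (h.partialSum_of_le r M K) <;>
      push_cast <;> ring
  · obtain ⟨r, rfl⟩ := Nat.exists_eq_add_of_le' hMN
    obtain rfl : N = d := by omega
    refine ⟨0, fun K => ?_⟩
    simpa using h.partialSum_of_ge r N K

/-- The Cauchy identity for a Cauchy pair. -/
theorem hasFormalSum (h : IsCauchyPair f F) (M N : ℕ) :
    HasFormalSum (fun l : DiagramOfDepthLE (min M N) => (-1) ^ l.1.card *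
        HahnSeries.C (exactQuot (alternantPoly f fun i : Fin M => l.1.rowLen i)
          (alternantPoly f 0)) *
        liftCoeffs M (exactQuot (alternant F (ddagger M l.1 : Fin N → ℤ)) (alternant F 0)))
      (∏ i : Fin M, ∏ j : Fin N,
        Ring.inverse (yVar (MvPolynomial (Fin M) ℂ) j + HahnSeries.C (MvPolynomial.X i))) := by
  simp only [inverse_yVar_add]
  change HasFormalSum _ (recipProd M N)
  obtain ⟨g, hg, hg'⟩ := h.exists_poly
  obtain ⟨c, hc⟩ := h.exists_partialSum_mem M N
  set t : DiagramOfDepthLE (min M N) → MvLaurentAtInfty N (MvPolynomial (Fin M) ℂ) := fun l =>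
    (-1) ^ l.1.card * HahnSeries.C (exactQuot (alternantPoly f fun i : Fin M => l.1.rowLen i)
      (alternantPoly f 0)) *
      liftCoeffs M (exactQuot (alternant F (ddagger M l.1 : Fin N → ℤ)) (alternant F 0)) with ht
  have hmul : ∀ l, t l * (HahnSeries.C (alternantPoly (N := M) f 0) *
      liftCoeffs M (alternant (N := N) F 0)) = (-1) ^ l.1.card *
        HahnSeries.C (alternantPoly f fun i : Fin M => l.1.rowLen i) *
        liftCoeffs M (alternant F (ddagger M l.1 : Fin N → ℤ)) := by
    intro l
    conv_rhs => rw [← exactQuot_mul (exists_alternantPoly f h.monic fun i : Fin M => l.1.rowLen i),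
      ← exactQuot_mul (exists_alternant F g hg hg' (ddagger M l.1 : Fin N → ℤ)), map_mul,
      ← liftCoeffsHom_apply, map_mul, liftCoeffsHom_apply, liftCoeffsHom_apply]
    rw [ht]
    ring
  have hmem : ∀ l, t l ∈ filtration N _ (-(N * N : ℕ)) (l.1.card - (N * N : ℕ)) := by
    intro l
    apply h.mem_filtration_of_mul
    rw [hmul]
    have h1 := mul_mem_filtration (C_mem_filtration (N := N)
      ((-1) ^ l.1.card * alternantPoly f fun i : Fin M => l.1.rowLen i))
      (h.liftCoeffs_alternant_ddagger_mem (M := M) l.1 (l.2.trans (min_le_right M N)))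
    simpa only [zero_add, map_mul, map_pow, map_neg, map_one] using h1
  refine hasFormalSum_of_filtration t _ (boundedDiagrams (min M N)) (-(N * N + c : ℕ))
    (N * N + c + N : ℕ) (-(N * N : ℕ)) (fun l => ?_) (fun K l hl => ?_) (fun K => ?_)
  · exact filtration_mono (by omega) (by omega) (hmem l)
  · have h1 := le_card_add_of_notMem hl
    have h2 := min_le_right M N
    exact filtration_mono (by omega) (by omega) (hmem l)
  · apply h.mem_filtration_of_mul
    rw [sub_mul, Finset.sum_mul, Finset.sum_congr rfl fun l _ => hmul l]
    exact filtration_mono (by omega) (by omega) (hc K)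

end IsCauchyPair

end SchurType

theorem theorem6p2 (Q : DeltaOperator) (hQ : Q.IsNormalized) (M N : ℕ) :
    (∀ (i : Fin M) (j : Fin N),
      IsUnit (yVar (MvPolynomial (Fin M) ℂ) j + HahnSeries.C (MvPolynomial.X i))) ∧
    HasFormalSum
      (fun l : DiagramOfDepthLE (min M N) =>
        (-1) ^ l.1.card *
          HahnSeries.C (Q.schurStarPoly fun i : Fin M => l.1.rowLen i) *
          liftCoeffs M (Q.schur (ddagger M l.1 : Fin N → ℤ)))
      (∏ i : Fin M, ∏ j : Fin N,
        Ring.inverse (yVar (MvPolynomial (Fin M) ℂ) j + HahnSeries.C (MvPolynomial.X i))) ∧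
    HasFormalSum
      (fun l : DiagramOfDepthLE (min M N) =>
        (-1) ^ l.1.card *
          HahnSeries.C (Q.schurPoly fun i : Fin M => l.1.rowLen i) *
          liftCoeffs M (Q.schurStar (ddagger M l.1 : Fin N → ℤ)))
      (∏ i : Fin M, ∏ j : Fin N,
        Ring.inverse (yVar (MvPolynomial (Fin M) ℂ) j + HahnSeries.C (MvPolynomial.X i))) :=
  ⟨isUnit_yVar_add, (isCauchyPair_basicStar Q hQ).hasFormalSum M N,
    (isCauchyPair_basic Q hQ).hasFormalSum M N⟩
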